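/- **Setting.** Consider perturbative $SU(2)$ Yang–Mills theory on Euclidean $\mathbb R^4$ with gauge parameter $\xi>0$, coupling $g$, fields $A^a_\mu$ (commuting) and $c^a,\bar c^a$ (anticommuting), $a\in\{1,2,3\}$, and momentum cutoffs $0<\Lambda\le\Lambda_0$. All functionals are formal power series in $\hbar$ and in the fields and sources; functional derivatives are left derivatives; $f(p)=\int d^4x\,e^{-ipx}f(x)$. Put $\sigma_\lambda(s)=e^{-s^2/\lambda^4}$, $\sigma_{\Lambda\Lambda_0}=\sigma_{\Lambda_0}-\sigma_\Lambda$, $\sigma_{0\Lambda_0}=\sigma_{\Lambda_0}$, $$C_{\mu\nu}(p)=\frac1{p^2}\Big(\delta_{\mu\nu}+(\xi-1)\frac{p_\mu p_\nu}{p^2}\Big),\quad S(p)=\frac1{p^2},\quad C^{\Lambda\Lambda_0}_{\mu\nu}=C_{\mu\nu}\,\sigma_{\Lambda\Lambda_0}(p^2),\quad S^{\Lambda\Lambda_0}=S\,\sigma_{\Lambda\Lambda_0}(p^2).$$ The covariance $\mathbf C=\mathbf C^{\Lambda\Lambda_0}$ is diagonal in colour, with entries $\mathbf C_{AA}=C^{\Lambda\Lambda_0}$,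 $\mathbf C_{c\bar c}=-S^{\Lambda\Lambda_0}$, $\mathbf C_{\bar cc}=S^{\Lambda\Lambda_0}$ and zero otherwise; $\hat{\mathbf 1}$ is $-1$ on $c,\bar c$ and $1$ on $A$. The bare Lagrangian is $\mathcal L=\mathcal L_0+\mathcal L_{ct}$, with $$\mathcal L_0=g\epsilon_{abc}(\partial_\mu A^a_\nu)A^b_\mu A^c_\nu+\tfrac{g^2}4\epsilon_{cab}\epsilon_{cds}A^a_\mu A^b_\nu A^d_\mu A^s_\nu-g\epsilon_{abc}(\partial_\mu\bar c^a)A^b_\mu c^c,$$ $$\begin{aligned}\mathcal L_{ct}=\;&r^{0,\bar cc\bar cc}\,\bar c^bc^b\bar c^ac^a+r^{0,\bar ccAA}_1\bar c^bc^bA^a_\mu A^a_\mu+r^{0,\bar ccAA}_2\bar c^ac^bA^a_\mu A^b_\mu+r^{0,AAAA}_1A^b_\mu A^b_\nu A^a_\mu A^a_\nu\\&+r^{0,AAAA}_2A^b_\nu A^b_\nu A^a_\mu A^a_\mu+2\epsilon_{abc}r^{0,AAA}(\partial_\mu A^a_\nu)A^b_\mu A^c_\nu-r^{0,A\bar cc}_1\epsilon_{abd}(\partial_\mu\bar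 c^a)A^b_\mu c^d\\&-r^{0,A\bar cc}_2\epsilon_{abd}\,\bar c^aA^b_\mu\partial_\mu c^d+\Sigma^{0,\bar cc}\bar c^a\partial^2c^a-\tfrac12\Sigma^{0,AA}_TA^a_\mu(\partial^2\delta_{\mu\nu}-\partial_\mu\partial_\nu)A^a_\nu\\&+\tfrac1{2\xi}\Sigma^{0,AA}_L(\partial_\mu A^a_\mu)^2+\tfrac12\delta m^2_{AA}A^a_\mu A^a_\mu-\delta m^2_{\bar cc}\,\bar c^ac^a,\end{aligned}$$ where all thirteen coefficients are arbitrary formal power series in $\hbar$ without constant term. Let $R_i=1+O(\hbar)$ ($i=1,2,3$) be formal power series, $L=\int d^4x\,\mathcal L$, and put $$\psi^a_\mu=R_1\partial_\mu c^a+gR_2\epsilon_{abs}A^b_\mu c^s,\qquad \Omega^a=\tfrac12gR_3\epsilon_{bsa}c^bc^s,\qquad Q_\beta=\sigma_{0\Lambda_0}*\Big(\frac{\delta L}{\delta\bar c}-\partial\psi\Big)-S^{-1}c,$$ $$Q_\rho=\frac{\delta L}{\delta A_\mu}\,\sigma_{0\Lambda_0}*\psi_\mu-\frac{\delta L}{\delta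 c}\,\sigma_{0\Lambda_0}*\Omega-\frac1\xi\frac{\delta L}{\delta\bar c}\,\sigma_{0\Lambda_0}*\partial A+A\,C^{-1}\psi-\bar c\,S^{-1}\Omega+\frac1\xi\,\partial A\,S^{-1}c,$$ $$\begin{aligned}Q_{\rho\gamma^a_\mu}=\;&g(R_3-R_2)\epsilon^{abs}(\sigma_{0\Lambda_0}*\psi^b_\mu)c^s+gR_1R_3\epsilon^{abs}\big(c^s(\sigma_{0\Lambda_0}*\partial_\mu c^b)-\sigma_{0\Lambda_0}*(c^s\partial_\mu c^b)\big)\\&+g^2R_2R_3\epsilon^{ase}\epsilon^{ebt}\big((\sigma_{0\Lambda_0}*(A^b_\mu c^t))c^s-A^b_\mu(\sigma_{0\Lambda_0}*(c^tc^s))\big),\end{aligned}$$ $$Q_{\rho\omega^a}=(gR_3)^2c^s\big(\sigma_{0\Lambda_0}*(c^ac^s)\big).$$ With sources $\gamma^a_\mu,\beta^a,\rho$ (anticommuting) and $\omega^a$ (commuting) let $$\mathcal L_{aux}=\mathcal L+\gamma\psi+\omega\Omega+\rho\,Q_\rho+\rho\gamma\,Q_{\rho\gamma}+\rho\omega\,Q_{\rho\omega}+\beta\,Q_\beta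 .$$ The generating functional $\Gamma^{\Lambda\Lambda_0}$ of the vertex functions, depending on the fields and sources, is the perturbative solution, order by order in $\hbar$, of the flow equation with boundary condition $$\partial_\Lambda\Gamma=\frac\hbar2\Big\langle\hat{\mathbf 1}\,\partial_\Lambda\mathbf C,\ \Gamma''\,(1+\hat{\mathbf 1}\mathbf C\,\Gamma'')^{-1}\Big\rangle,\qquad \Gamma''_{\phi\phi'}=\frac{\delta^2\Gamma}{\delta\phi\,\delta\phi'}\ \ (\phi,\phi'\in\{A,c,\bar c\}),\qquad \Gamma^{\Lambda_0\Lambda_0}=\int d^4x\,\mathcal L_{aux}.$$ Its moments, in momentum space and stripped of the momentum-conservation delta function, are the vertex functions $\Gamma^{\Lambda\Lambda_0;\vec\phi}_{\vec\chi}(\vec p)$ with fields $\vec\phi$ and insertions of the sources $\vec\chi$ (the field derivatives stand to the left of the source derivatives). Here $\vec p=(p_0,\dots,p_{n-1})$, ordered as $(\vec\chi,\vec\phi)$, with $p_0=-\sum_{i\ge1}p_i$. An upper index $w=(w_0,\dots,w_{n-1})$ with $w_0=0$ denotes the tensor of all partial derivatives of order $w_i$ with respect to $p_i$, $i\ge1$;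 $\|w\|=\sum_iw_i$. The index $1$ denotes the integrated insertion $\int d^4x\,\delta/\delta\rho(x)$, that is, $\rho$ at momentum zero, which is not counted among the momenta. Let $\vec\varkappa$ denote any finite, possibly empty, sequence of $n_\varkappa$ sources from $\{\gamma,\omega\}$. **Hypotheses.** Let $0<M\le\Lambda_0$, and assume the following in every order in $\hbar$. 1. $\Gamma^{0\Lambda_0;\vec\phi;w}_{\vec\varkappa}(0)=0$ whenever $\vec\phi$ consists of $N$ fields, $N+n_\varkappa\ge1$ and $2n_\varkappa+N+\|w\|<4$, where the value at $\Lambda=0$ is the limit $\Lambda\to0^+$. 2. $\Gamma^{M\Lambda_0;c\bar cc\bar c}(0)=0$, $\ \Gamma^{M\Lambda_0;c\bar cAA}(0)=0$, $\ \partial_{p_A}\Gamma^{M\Lambda_0;c\bar cA}(0)=0$. **Proposition.** Under these hypotheses the following hold in every order in $\hbar$ and for all $0<\Lambda\le\Lambda_0$. (a) For every sequence $\vec\phi\,\bar c$ of $N\ge3$ labels in $\{A,c,\bar c\}$ with last label $\bar c$, every multi-index $w=(w',0)$ and all $(\vec p,0)$ with vanishing total momentum, $$\Gamma^{\Lambda\Lambda_0;\vec\phi\bar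 c;w}(\vec p,0)=0 .$$ (b) $r^{0,\bar ccAA}_1=0$, $\ r^{0,\bar cc\bar cc}=0$, $\ r^{0,\bar ccAA}_2=0$, $\ r^{0,A\bar cc}_2=0$. (c) For $X\in\{\beta,1\}$, every $\vec\varkappa$, every $\vec\phi\,\bar c$ as in (a), every multi-index $w=(w',0)$ and all $(\vec p,0)$ with vanishing total momentum, $$\Gamma^{\Lambda\Lambda_0;\vec\phi\bar c;w}_{X\vec\varkappa}(\vec p,0)=0 .$$ -/

import Mathlib

open scoped PowerSeries Topology

noncomputable section

namespace YangMills

/-- Momenta, i.e. vectors of Euclidean `ℝ⁴`. -/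
abbrev Mom := EuclideanSpace ℝ (Fin 4)

/-- Labels: the fields `A^a_μ`, `c^a`, `c̄^a` and the sources `γ^a_μ`, `ω^a`, `β^a`, `ρ`
of composite operators. Colour indices are in `Fin 3`, Lorentz indices in `Fin 4`. -/
inductive Lab
  | A (a : Fin 3) (μ : Fin 4)
  | c (a : Fin 3)
  | cbar (a : Fin 3)
  | gamma (a : Fin 3) (μ : Fin 4)
  | omega (a : Fin 3)
  | beta (a : Fin 3)
  | rho
  deriving DecidableEq, Fintype

/-- The anticommuting variables are `c, c̄, γ, β, ρ`; the others commute. -/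
def Lab.odd : Lab → Bool
  | .A _ _ => false
  | .c _ => true
  | .cbar _ => true
  | .gamma _ _ => true
  | .omega _ => false
  | .beta _ => true
  | .rho => true

/-- `A`, `c` or `c̄`. -/
def Lab.IsField : Lab → Prop
  | .A _ _ => True
  | .c _ => True
  | .cbar _ => True
  | _ => False

/-- `γ` or `ω`. -/
def Lab.IsKappa : Lab → Prop
  | .gamma _ _ => True
  | .omega _ => True
  | _ => False

/-- A leg of a vertex: a label together with its momentum. -/
abbrev Leg := Lab × Mom

/-- The total momentum of a list of legs. -/
def total (legs : List Leg) : Mom := (legs.map Prod.snd).sum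

/-- The number of anticommuting legs. -/
def oddCount (legs : List Leg) : ℕ := legs.countP (fun x => x.1.odd)

/-! ### Polynomials in the fields and sources

A local (or smeared) polynomial `F(x)` in the fields and sources, with coefficients that are formal
power series in `ħ`, is represented by its vertex functions: `F [(φ₀,p₀), …, (φₙ,pₙ)]` is
`∫ ∏ dx_i e^{-i p_i x_i} δ/δφ₀(x₀) ⋯ δ/δφₙ(xₙ) F(0)` at vanishing fields (left derivatives).
On legs of total momentum zero it is also the vertex function of `∫ dx F(x)`
stripped of the momentum-conservation delta function. -/

/-- Vertex functions of an operator, as formal power series in `ħ`. -/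
abbrev Op := List Leg → ℂ⟦X⟧

/-- A number as a power series in `ħ`. -/
def num (z : ℂ) : ℂ⟦X⟧ := PowerSeries.C z

/-- The elementary field (or source) `φ(x)`. -/
def fld (φ : Lab) : Op
  | [x] => if x.1 = φ then 1 else 0
  | _ => 0

/-- The product `F(x) G(x)`: every leg acts either on `F` or on `G`
(graded Leibniz rule for left derivatives). A pair of odd legs contributes a minus sign
when the left one of the two acts on `F` and the right one acts on `G`. -/
def opMul : Op → Op → List Leg → ℂ⟦X⟧
  | F, G, [] => F [] * G []
  | F, G, x :: xs =>
      opMul (fun ys => F (x :: ys))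
          (fun ys => (if x.1.odd then (-1) ^ oddCount ys else 1) * G ys) xs
        + opMul F (fun ys => G (x :: ys)) xs

local infixl:70 " ⋆ " => opMul

/-- Convolution with (multiplication in momentum space by) an even function `f` of the momentum. -/
def conv (f : Mom → ℂ) (F : Op) : Op := fun legs => num (f (total legs)) * F legs

/-- The derivative `∂_μ F`. With the above Fourier convention `∂_μ` is `-i` times the momentum. -/
def der (μ : Fin 4) (F : Op) : Op :=
  fun legs => num (-Complex.I * ((total legs μ : ℝ) : ℂ)) * F legs

/-- The Laplacian `∂² F`. -/
def lap (F : Op) : Op := ∑ μ : Fin 4, der μ (der μ F)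

/-- The left functional derivative `δ/δφ(x) ∫ dy F(y)`. -/
def funcDeriv (φ : Lab) (F : Op) : Op := fun legs => F (legs ++ [(φ, -total legs)])

/-- The Levi-Civita symbol. -/
def eps (a b c : Fin 3) : ℤ :=
  ((b : ℤ) - (a : ℤ)) * ((c : ℤ) - (b : ℤ)) * ((c : ℤ) - (a : ℤ)) / 2

def fA (a : Fin 3) (μ : Fin 4) : Op := fld (.A a μ)
def fc (a : Fin 3) : Op := fld (.c a)
def fcb (a : Fin 3) : Op := fld (.cbar a)

/-! ### The regularized propagators -/

/-- `σ_λ(p²) = exp(-p⁴/λ⁴)`. This is also `σ_{0λ}(p²)`, since `σ_λ → 0` as `λ → 0`. -/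
def sigma (lam : ℝ) (p : Mom) : ℝ := Real.exp (-(‖p‖ ^ 2) ^ 2 / lam ^ 4)

/-- `σ_{ΛΛ₀} = σ_{Λ₀} - σ_Λ`. -/
def sigma2 (Λ Λ₀ : ℝ) (p : Mom) : ℝ := sigma Λ₀ p - sigma Λ p

/-- `C^{ΛΛ₀}_{μν}(p)`. -/
def propC (ξ Λ Λ₀ : ℝ) (μ ν : Fin 4) (p : Mom) : ℝ :=
  1 / ‖p‖ ^ 2 * ((if μ = ν then 1 else 0) + (ξ - 1) * (p μ * p ν / ‖p‖ ^ 2)) * sigma2 Λ Λ₀ p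

/-- `S^{ΛΛ₀}(p)`. -/
def propS (Λ Λ₀ : ℝ) (p : Mom) : ℝ := 1 / ‖p‖ ^ 2 * sigma2 Λ Λ₀ p

/-- The covariance matrix `𝐂^{ΛΛ₀}` on `(A, c, c̄)`: `𝐂_{AA} = C`, `𝐂_{c c̄} = -S`,
`𝐂_{c̄ c} = S`; there is no propagation of sources. -/
def covar (ξ Λ Λ₀ : ℝ) : Lab → Lab → Mom → ℝ
  | .A a μ, .A b ν, p => if a = b then propC ξ Λ Λ₀ μ ν p else 0
  | .c a, .cbar b, p => if a = b then -propS Λ Λ₀ p else 0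
  | .cbar a, .c b, p => if a = b then propS Λ Λ₀ p else 0
  | _, _, _ => 0

/-- The matrix `1̂ ∂_Λ 𝐂^{ΛΛ₀}`, where `1̂` is `-1` on the ghost block and `1` otherwise. -/
def covarDot (ξ Λ Λ₀ : ℝ) (φ φ' : Lab) (p : Mom) : ℝ :=
  (if φ.odd then -1 else 1) * deriv (fun t : ℝ => covar ξ t Λ₀ φ φ' p) Λ

/-! ### The bare Lagrangian -/

/-- The bare constants (formal power series in `ħ`): the eleven marginal and two strictly relevant
counterterms, all of order `O(ħ)`, and the constants `R_i = 1 + O(ħ)` of the BRST operators. -/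
structure BareConstants where
  /-- `r^{0, c̄cc̄c}` -/
  rcbccbc : ℂ⟦X⟧
  /-- `r^{0, c̄cAA}_1` -/
  rcbcAA1 : ℂ⟦X⟧
  /-- `r^{0, c̄cAA}_2` -/
  rcbcAA2 : ℂ⟦X⟧
  /-- `r^{0, AAAA}_1` -/
  rAAAA1 : ℂ⟦X⟧
  /-- `r^{0, AAAA}_2` -/
  rAAAA2 : ℂ⟦X⟧
  /-- `r^{0, AAA}` -/
  rAAA : ℂ⟦X⟧
  /-- `r^{0, Ac̄c}_1` -/
  rAcbc1 : ℂ⟦X⟧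
  /-- `r^{0, Ac̄c}_2` -/
  rAcbc2 : ℂ⟦X⟧
  /-- `Σ^{0, c̄c}` -/
  Scbc : ℂ⟦X⟧
  /-- `Σ^{0, AA}_T` -/
  SAAT : ℂ⟦X⟧
  /-- `Σ^{0, AA}_L` -/
  SAAL : ℂ⟦X⟧
  /-- `δm²_{AA}` -/
  mAA : ℂ⟦X⟧
  /-- `δm²_{c̄c}` -/
  mcbc : ℂ⟦X⟧
  R1 : ℂ⟦X⟧
  R2 : ℂ⟦X⟧
  R3 : ℂ⟦X⟧
  tree_ct : ∀ r ∈ [rcbccbc, rcbcAA1, rcbcAA2, rAAAA1, rAAAA2, rAAA, rAcbc1, rAcbc2,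
    Scbc, SAAT, SAAL, mAA, mcbc], PowerSeries.constantCoeff r = 0
  tree_R : ∀ r ∈ [R1, R2, R3], PowerSeries.constantCoeff r = 1

/-- The classical interaction Lagrangian density. -/
def lagr0 (g : ℝ) : Op :=
  (∑ a, ∑ b, ∑ c, ∑ μ, ∑ ν, num (g * eps a b c) • (der μ (fA a ν) ⋆ fA b μ ⋆ fA c ν))
  + (∑ a, ∑ b, ∑ c, ∑ d, ∑ s, ∑ μ, ∑ ν, num (g ^ 2 / 4 * eps c a b * eps c d s) •
      (fA a μ ⋆ fA b ν ⋆ fA d μ ⋆ fA s ν))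
  - (∑ a, ∑ b, ∑ c, ∑ μ, num (g * eps a b c) • (der μ (fcb a) ⋆ fA b μ ⋆ fc c))

/-- The counterterm Lagrangian density. -/
def lagrCt (ξ : ℝ) (r : BareConstants) : Op :=
  (∑ a, ∑ b, r.rcbccbc • (fcb b ⋆ fc b ⋆ fcb a ⋆ fc a))
  + (∑ a, ∑ b, ∑ μ, r.rcbcAA1 • (fcb b ⋆ fc b ⋆ fA a μ ⋆ fA a μ))
  + (∑ a, ∑ b, ∑ μ, r.rcbcAA2 • (fcb a ⋆ fc b ⋆ fA a μ ⋆ fA b μ))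
  + (∑ a, ∑ b, ∑ μ, ∑ ν, r.rAAAA1 • (fA b μ ⋆ fA b ν ⋆ fA a μ ⋆ fA a ν))
  + (∑ a, ∑ b, ∑ μ, ∑ ν, r.rAAAA2 • (fA b ν ⋆ fA b ν ⋆ fA a μ ⋆ fA a μ))
  + (∑ a, ∑ b, ∑ c, ∑ μ, ∑ ν,
      (num (2 * eps a b c) * r.rAAA) • (der μ (fA a ν) ⋆ fA b μ ⋆ fA c ν))
  - (∑ a, ∑ b, ∑ d, ∑ μ,
      (num (eps a b d) * r.rAcbc1) • (der μ (fcb a) ⋆ fA b μ ⋆ fc d))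
  - (∑ a, ∑ b, ∑ d, ∑ μ,
      (num (eps a b d) * r.rAcbc2) • (fcb a ⋆ fA b μ ⋆ der μ (fc d)))
  + (∑ a, r.Scbc • (fcb a ⋆ lap (fc a)))
  - (∑ a, ∑ μ, ∑ ν, (num (1 / 2) * r.SAAT) •
      (fA a μ ⋆ ((if μ = ν then lap (fA a ν) else 0) - der μ (der ν (fA a ν)))))
  + (∑ a, ∑ μ, ∑ ν, (num (1 / (2 * ξ)) * r.SAAL) • (der μ (fA a μ) ⋆ der ν (fA a ν)))
  + (∑ a, ∑ μ, (num (1 / 2) * r.mAA) • (fA a μ ⋆ fA a μ))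
  - (∑ a, r.mcbc • (fcb a ⋆ fc a))

/-- The bare interaction Lagrangian density `ℒ^{Λ₀Λ₀}`. -/
def lagr (ξ g : ℝ) (r : BareConstants) : Op := lagr0 g + lagrCt ξ r

/-! ### BRST operators and the operators describing the violation of the STI and of the AGE -/

/-- `ψ = R₁ ∂c - i g R₂ [A, c]` in components. -/
def psi (g : ℝ) (r : BareConstants) (a : Fin 3) (μ : Fin 4) : Op :=
  r.R1 • der μ (fc a) + ∑ b, ∑ s, (num (g * eps a b s) * r.R2) • (fA b μ ⋆ fc s)

/-- `Ω = (1/2i) g R₃ {c, c}`, with `{c,c}^d = i ε_{abd} c^a c^b`, in components. -/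
def Omega (g : ℝ) (r : BareConstants) (d : Fin 3) : Op :=
  ∑ a, ∑ b, (num (g / 2 * eps a b d) * r.R3) • (fc a ⋆ fc b)

/-- Convolution with `σ_{0Λ₀}`. -/
def smear (Λ₀ : ℝ) (F : Op) : Op := conv (fun p => ((sigma Λ₀ p : ℝ) : ℂ)) F

/-- `S⁻¹ F`, where `S⁻¹(p) = p²`. -/
def invS (F : Op) : Op := conv (fun p => ((‖p‖ ^ 2 : ℝ) : ℂ)) F

/-- `(C⁻¹ ψ)_μ`, where `C⁻¹_{μν}(p) = p² δ_{μν} + (1/ξ - 1) p_μ p_ν`. -/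
def invC (ξ : ℝ) (F : Fin 4 → Op) (μ : Fin 4) : Op :=
  ∑ ν, conv (fun p => ((‖p‖ ^ 2 * (if μ = ν then 1 else 0) + (1 / ξ - 1) * (p μ * p ν) : ℝ) : ℂ))
    (F ν)

def Qrho (ξ g Λ₀ : ℝ) (r : BareConstants) : Op :=
  (∑ a, ∑ μ, (funcDeriv (.A a μ) (lagr ξ g r) ⋆ smear Λ₀ (psi g r a μ)))
  - (∑ a, (funcDeriv (.c a) (lagr ξ g r) ⋆ smear Λ₀ (Omega g r a)))
  - (∑ a, ∑ μ, num (1 / ξ) • (funcDeriv (.cbar a) (lagr ξ g r) ⋆ smear Λ₀ (der μ (fA a μ))))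
  + (∑ a, ∑ μ, (fA a μ ⋆ invC ξ (psi g r a) μ))
  - (∑ a, (fcb a ⋆ invS (Omega g r a)))
  + (∑ a, ∑ μ, num (1 / ξ) • (der μ (fA a μ) ⋆ invS (fc a)))

def Qbeta (ξ g Λ₀ : ℝ) (r : BareConstants) (a : Fin 3) : Op :=
  smear Λ₀ (funcDeriv (.cbar a) (lagr ξ g r) - ∑ μ, der μ (psi g r a μ)) - invS (fc a)

def QrhoGamma (g Λ₀ : ℝ) (r : BareConstants) (a : Fin 3) (μ : Fin 4) : Op :=
  (∑ b, ∑ s, (num (g * eps a b s) * (r.R3 - r.R2)) • (smear Λ₀ (psi g r b μ) ⋆ fc s))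
  + (∑ b, ∑ s, (num (g * eps a b s) * r.R1 * r.R3) •
      (fc s ⋆ smear Λ₀ (der μ (fc b)) - smear Λ₀ (fc s ⋆ der μ (fc b))))
  + (∑ s, ∑ e, ∑ b, ∑ t, (num (g ^ 2 * eps a s e * eps e b t) * r.R2 * r.R3) •
      (smear Λ₀ (fA b μ ⋆ fc t) ⋆ fc s - fA b μ ⋆ smear Λ₀ (fc t ⋆ fc s)))

def QrhoOmega (g Λ₀ : ℝ) (r : BareConstants) (a : Fin 3) : Op :=
  ∑ s, (num g * r.R3) ^ 2 • (fc s ⋆ smear Λ₀ (fc a ⋆ fc s))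

/-- The full bare Lagrangian density
`ℒ + γ ψ + ω Ω + ρ Q_ρ + ρ γ Q_{ργ} + ρ ω Q_{ρω} + β Q_β`. -/
def lagrAux (ξ g Λ₀ : ℝ) (r : BareConstants) : Op :=
  lagr ξ g r
  + (∑ a, ∑ μ, (fld (.gamma a μ) ⋆ psi g r a μ))
  + (∑ a, (fld (.omega a) ⋆ Omega g r a))
  + (fld .rho ⋆ Qrho ξ g Λ₀ r)
  + (∑ a, ∑ μ, (fld .rho ⋆ fld (.gamma a μ) ⋆ QrhoGamma g Λ₀ r a μ))
  + (∑ a, (fld .rho ⋆ fld (.omega a) ⋆ QrhoOmega g Λ₀ r a))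
  + (∑ a, (fld (.beta a) ⋆ Qbeta ξ g Λ₀ r a))

/-! ### The flow equation

`∂_Λ Γ = (ħ/2) ⟨1̂ ∂_Λ𝐂, Γ'' (1 + 1̂ 𝐂 Γ'')⁻¹⟩`, expanded in chains of vertex functions. -/

/-- The part `Ψ_j` of the legs which a division `f` in `m` parts attributes to the `j`-th part. -/
def part {m : ℕ} (legs : List Leg) (f : Fin legs.length → Fin m) (j : Fin m) : List Leg :=
  ((List.finRange legs.length).filter (fun i => f i = j)).map legs.get

/-- `(-)^{π_a}`: the sign of the permutation of the anticommuting legs which brings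
the sequence of legs into the order `Ψ_1 ⊕ ⋯ ⊕ Ψ_m`. -/
def divSign {m : ℕ} (legs : List Leg) (f : Fin legs.length → Fin m) : ℂ :=
  ∏ i, ∏ j, if i < j ∧ f j < f i ∧ (legs.get i).1.odd ∧ (legs.get j).1.odd then -1 else 1

/-- The momentum that enters the `j`-th vertex of a chain through its left internal line
when the momentum `k` enters the chain. -/
def lineMom {m : ℕ} (legs : List Leg) (f : Fin legs.length → Fin m) (k : Mom) (j : ℕ) : Mom :=
  k + ∑ i, if (f i : ℕ) < j then (legs.get i).2 else 0

/-- A chain of `m + 1` vertex functions of loop orders `ν j`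
`Γ^{ζ₀ Ψ₀ ζ̄₀} 𝐂_{ζ₁ ζ̄₀} Γ^{ζ₁ Ψ₁ ζ̄₁} ⋯ 𝐂_{ζ_m ζ̄_{m-1}} Γ^{ζ_m Ψ_m ζ̄_m}`
with internal labels `ζ`, `ζ'`. -/
def chain (ξ Λ₀ : ℝ) (W : ℕ → ℝ → List Leg → ℂ) (Λ : ℝ) (legs : List Leg) {m : ℕ}
    (f : Fin legs.length → Fin (m + 1)) (ν : Fin (m + 1) → ℕ) (ζ ζ' : Fin (m + 1) → Lab)
    (k : Mom) : ℂ :=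
  (∏ j : Fin (m + 1), W (ν j) Λ
      ((ζ j, lineMom legs f k j) :: (part legs f j ++ [(ζ' j, -lineMom legs f k (j + 1))])))
  * ∏ j : Fin m, ((covar ξ Λ Λ₀ (ζ j.succ) (ζ' j.castSucc) (lineMom legs f k (j + 1)) : ℝ) : ℂ)

/-- The integrand of the loop integral, for vertices of total loop order `l`: the sum over all
numbers `m + 1` of vertices, divisions of the external legs, loop orders and internal labels.
As the two-point functions without sources vanish at tree level,
a non-vanishing chain has at most `legs.length + l` vertices. -/
def loopIntegrand (ξ Λ₀ : ℝ) (W : ℕ → ℝ → List Leg → ℂ) (l : ℕ) (Λ : ℝ) (legs : List Leg)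
    (k : Mom) : ℂ :=
  ∑ m ∈ Finset.range (legs.length + l), ∑ f : Fin legs.length → Fin (m + 1),
    ∑ ν ∈ Finset.Nat.antidiagonalTuple (m + 1) l, ∑ ζ : Fin (m + 1) → Lab,
      ∑ ζ' : Fin (m + 1) → Lab,
        (-1) ^ m * divSign legs f * ((covarDot ξ Λ Λ₀ (ζ 0) (ζ' (Fin.last m)) k : ℝ) : ℂ)
          * chain ξ Λ₀ W Λ legs f ν ζ ζ' k

/-- The right-hand side of the flow equation at order `ħ^{l+1}`. -/
def flowRhs (ξ Λ₀ : ℝ) (W : ℕ → ℝ → List Leg → ℂ) (l : ℕ) (Λ : ℝ) (legs : List Leg) : ℂ :=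
  1 / 2 * (1 / ((2 * Real.pi : ℝ) : ℂ) ^ 4) * ∫ k : Mom, loopIntegrand ξ Λ₀ W l Λ legs k

/-- The vertex functions `Γ_l^{ΛΛ₀}` in loop order `l`, for `0 < Λ ≤ Λ₀`: the solution of the
flow equation which at `Λ = Λ₀` is given by the bare Lagrangian. The value on a list of legs is
the functional derivative of `Γ` with respect to the variables in the order of the list;
only lists of total momentum zero are meaningful. -/
def vertex (ξ g Λ₀ : ℝ) (r : BareConstants) : ℕ → ℝ → List Leg → ℂ
  | 0 => fun _ legs => PowerSeries.coeff 0 (lagrAux ξ g Λ₀ r legs)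
  | l + 1 => fun Λ legs => PowerSeries.coeff (l + 1) (lagrAux ξ g Λ₀ r legs)
      - ∫ t in Λ..Λ₀,
          flowRhs ξ Λ₀ (fun j => if _h : j ≤ l then vertex ξ g Λ₀ r j else 0) l t legs
  termination_by l => l

theorem flowRhs_congr (ξ Λ₀ : ℝ) {W W' : ℕ → ℝ → List Leg → ℂ} {l : ℕ}
    (h : ∀ j ≤ l, W j = W' j) (Λ : ℝ) (legs : List Leg) :
    flowRhs ξ Λ₀ W l Λ legs = flowRhs ξ Λ₀ W' l Λ legs := by
  have hc : ∀ k : Mom, loopIntegrand ξ Λ₀ W l Λ legs k = loopIntegrand ξ Λ₀ W' l Λ legs k := by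
    intro k
    unfold loopIntegrand
    apply Finset.sum_congr rfl; intro m _
    apply Finset.sum_congr rfl; intro f _
    apply Finset.sum_congr rfl; intro ν hν
    have hν' : ∀ j, W (ν j) = W' (ν j) := by
      intro j
      apply h
      rw [Finset.Nat.mem_antidiagonalTuple] at hν
      rw [← hν]
      exact Finset.single_le_sum (f := ν) (fun _ _ => Nat.zero_le _) (Finset.mem_univ j)
    simp only [chain, hν']
  simp only [flowRhs, hc]

/-- At tree level the vertex functions do not flow. -/
theorem vertex_zero (ξ g Λ₀ : ℝ) (r : BareConstants) (Λ : ℝ) (legs : List Leg) :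
    vertex ξ g Λ₀ r 0 Λ legs = PowerSeries.coeff 0 (lagrAux ξ g Λ₀ r legs) := by
  rw [vertex]

/-- The flow equation, integrated from `Λ₀` down to `Λ`. -/
theorem vertex_succ (ξ g Λ₀ : ℝ) (r : BareConstants) (l : ℕ) (Λ : ℝ) (legs : List Leg) :
    vertex ξ g Λ₀ r (l + 1) Λ legs = PowerSeries.coeff (l + 1) (lagrAux ξ g Λ₀ r legs)
      - ∫ t in Λ..Λ₀, flowRhs ξ Λ₀ (vertex ξ g Λ₀ r) l t legs := by
  have hc : ∀ t : ℝ, flowRhs ξ Λ₀ (fun j => if _h : j ≤ l then vertex ξ g Λ₀ r j else 0) l t legs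
      = flowRhs ξ Λ₀ (vertex ξ g Λ₀ r) l t legs := by
    intro t
    apply flowRhs_congr
    intro j hj
    rw [dif_pos hj]
  rw [vertex]
  simp only [hc]

/-! ### Vertex functions with insertions, momentum derivatives, renormalization conditions -/

/-- `Γ_χ^φ(p)`, where the first `k` entries of `Ψ` are the sources `χ` and the remaining ones are
the fields `φ`, and `p` is the corresponding sequence of momenta. The derivatives with respect to
the fields stand to the left of those with respect to the sources. -/
def vertexFn (ξ g Λ₀ : ℝ) (r : BareConstants) (l : ℕ) (Λ : ℝ) (k : ℕ) {n : ℕ}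
    (Ψ : Fin n → Lab) (p : Fin n → Mom) : ℂ :=
  vertex ξ g Λ₀ r l Λ ((List.ofFn fun i => (Ψ i, p i)).rotate k)

/-- The components of `∂^w F`: the iterated partial derivatives with respect to the momentum
components `p_{i,μ}`, `(i, μ)` running through the list, of a function of momenta with sum zero,
where `p_{i₀}` is taken as minus the sum of the others. -/
def momDeriv {n : ℕ} (i₀ : Fin n) :
    List (Fin n × Fin 4) → ((Fin n → Mom) → ℂ) → (Fin n → Mom) → ℂ
  | [], F => F
  | d :: ds, F => fun p => lineDeriv ℝ (momDeriv i₀ ds F) p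
      (Pi.single d.1 (EuclideanSpace.single d.2 (1 : ℝ))
        - Pi.single i₀ (EuclideanSpace.single d.2 (1 : ℝ)))

/-- The strictly relevant terms without or with insertions of `γ`, `ω` vanish
at zero momentum and `Λ = 0` (as limit `Λ → 0⁺`). -/
def StrictlyRelevantConditions (ξ g Λ₀ : ℝ) (r : BareConstants) : Prop :=
  ∀ (l n k : ℕ) (Ψ : Fin (n + 1) → Lab), k ≤ n + 1 →
    (∀ i : Fin (n + 1), (i : ℕ) < k → (Ψ i).IsKappa) →
    (∀ i : Fin (n + 1), k ≤ (i : ℕ) → (Ψ i).IsField) →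
    ∀ w : List (Fin (n + 1) × Fin 4), (∀ d ∈ w, d.1 ≠ 0) →
      2 * k + (n + 1 - k) + w.length < 4 →
      Filter.Tendsto (fun Λ : ℝ => momDeriv 0 w (vertexFn ξ g Λ₀ r l Λ k Ψ) 0)
        (𝓝[>] 0) (𝓝 0)

/-- `Γ^{c c̄ c c̄}(0) = 0`, `Γ^{c c̄ A A}(0) = 0` and `∂_A Γ^{c c̄ A}(0) = 0` at `Λ = M`. -/
def MarginalConditions (ξ g Λ₀ M : ℝ) (r : BareConstants) : Prop :=
  ∀ l : ℕ,
    (∀ a b d e : Fin 3,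
      vertexFn ξ g Λ₀ r l M 0 ![Lab.c a, Lab.cbar b, Lab.c d, Lab.cbar e] 0 = 0) ∧
    (∀ (a b d e : Fin 3) (μ ν : Fin 4),
      vertexFn ξ g Λ₀ r l M 0 ![Lab.c a, Lab.cbar b, Lab.A d μ, Lab.A e ν] 0 = 0) ∧
    (∀ (a b d : Fin 3) (μ ν : Fin 4),
      momDeriv 0 [((2 : Fin 3), ν)]
        (vertexFn ξ g Λ₀ r l M 0 ![Lab.c a, Lab.cbar b, Lab.A d μ]) 0 = 0)

end YangMills

end

open scoped PowerSeries Topology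

noncomputable section

namespace YangMills

/-! ### Products of operators -/

/-! An antighost leg at momentum zero is never renormalized. In the loop on the right of the flow
equation an external `c̄` leg sits on some vertex of the chain, and this vertex also carries two
internal lines. Sources do not propagate, so both lines are fields, and the vertex is itself a
function with at least three fields, one of them `c̄` at momentum zero. Since the factor `ħ` makes
the right-hand side of order `l + 1` depend on orders at most `l`, vanishing in lower orders stops
the flow (`flowRhs_eq_zero`, `vertex_eq_coeff`), and the vertex function equals its bare value at
every scale.

The bare value is elementary. In the classical Lagrangian `c̄` enters only through `∂c̄`, which
vanishes at momentum zero; among the counterterms just six monomials contain an undifferentiated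
`c̄` (`lagr_apply`). The four of them with three or more fields have the coefficients of part (b),
and as nothing flows, the conditions at `M` read off these very coefficients. So the vanishing of
the coefficients and of the vertex functions is proved by one induction on the loop order
(`marginalCoeffsVanish_and_vertex_eq_zero`).

For `β` and `ρ` the two-point monomials matter as well, since `Q_β` and `Q_ρ` contain functional
derivatives of `L`. The kinetic term `c̄ ∂²c` vanishes by momentum conservation. The mass term
vanishes because the `c c̄` function at momentum zero does not flow either and tends to zero as `Λ →
0⁺` (`mcbc_eq_zero`). Then the whole bare action vanishes on the configurations in question
(`lagrAux_eq_zero`), and a second induction of the same kind gives (a) and (c) (`vertex_eq_zero`).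
Momentum derivatives come for free, being taken along directions that stay inside the zero set. -/

/-- Every term of the graded Leibniz expansion is `± F ys * G zs` with the legs split between the
factors; for vanishing results the signs are irrelevant. -/
theorem opMul_eq_zero {F G : Op} {legs : List Leg}
    (h : ∀ ys zs, (ys ++ zs).Perm legs → F ys = 0 ∨ G zs = 0) : opMul F G legs = 0 := by
  induction legs generalizing F G with
  | nil =>
    rcases h [] [] (by simp) with h | h <;> simp [opMul, h]
  | cons x xs ih =>
    rw [opMul, ih, ih, add_zero]
    · intro ys zs hp
      exact h ys (x :: zs) (List.perm_middle.trans (hp.cons x))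
    · intro ys zs hp
      rcases h (x :: ys) zs (hp.cons x) with h | h
      · exact Or.inl h
      · exact Or.inr (by simp [h])

theorem fld_eq_zero {φ : Lab} {legs : List Leg} (h : ∀ x ∈ legs, x.1 ≠ φ) :
    fld φ legs = 0 := by
  match legs with
  | [] => rfl
  | [x] => simpa [fld] using h
  | _ :: _ :: _ => rfl

theorem opMul_fld_eq_zero {φ : Lab} {G : Op} {legs : List Leg} (h : ∀ x ∈ legs, x.1 ≠ φ) :
    opMul (fld φ) G legs = 0 :=
  opMul_eq_zero fun _ _ hp =>
    Or.inl (fld_eq_zero fun x hx => h x (hp.subset (List.mem_append_left _ hx)))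

theorem eq_of_fld_ne_zero {φ : Lab} {legs : List Leg} (h : fld φ legs ≠ 0) :
    ∃ p, legs = [(φ, p)] := by
  match legs, h with
  | [], h => exact absurd rfl h
  | [(φ', p)], h =>
    refine ⟨p, ?_⟩
    by_cases h' : φ' = φ
    · rw [h']
    · exact absurd (by simp [fld, h']) h
  | _ :: _ :: _, h => exact absurd rfl h

/-- `F` vanishes as soon as one of its antighost legs has momentum zero. -/
def KillsCbar (F : Op) : Prop :=
  ∀ (legs : List Leg) (b : Fin 3), (Lab.cbar b, (0 : Mom)) ∈ legs → F legs = 0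

namespace KillsCbar

variable {F G : Op}

theorem zero : KillsCbar 0 := fun _ _ _ => rfl

theorem add (hF : KillsCbar F) (hG : KillsCbar G) : KillsCbar (F + G) :=
  fun legs b h => by simp [hF legs b h, hG legs b h]

theorem sub (hF : KillsCbar F) (hG : KillsCbar G) : KillsCbar (F - G) :=
  fun legs b h => by simp [hF legs b h, hG legs b h]

theorem smul (z : ℂ⟦X⟧) (hF : KillsCbar F) : KillsCbar (z • F) :=
  fun legs b h => by simp [hF legs b h]

theorem sum {ι : Type*} {s : Finset ι} {F : ι → Op} (hF : ∀ i, KillsCbar (F i)) :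
    KillsCbar (∑ i ∈ s, F i) :=
  fun legs b h => by
    rw [Finset.sum_apply]
    exact Finset.sum_eq_zero fun i _ => hF i legs b h

theorem conv (f : Mom → ℂ) (hF : KillsCbar F) : KillsCbar (conv f F) :=
  fun legs b h => by simp [YangMills.conv, hF legs b h]

theorem der (μ : Fin 4) (hF : KillsCbar F) : KillsCbar (der μ F) :=
  fun legs b h => by simp [YangMills.der, hF legs b h]

theorem lap (hF : KillsCbar F) : KillsCbar (lap F) :=
  sum fun _ => (hF.der _).der _

/-- The antighost leg at momentum zero is handed to one of the two factors, and either factor kills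
it. -/
theorem opMul (hF : KillsCbar F) (hG : KillsCbar G) : KillsCbar (opMul F G) :=
  fun legs b h => opMul_eq_zero fun ys zs hp => by
    rcases List.mem_append.1 (hp.symm.subset h) with h | h
    · exact Or.inl (hF ys b h)
    · exact Or.inr (hG zs b h)

theorem fld {φ : Lab} (h : ∀ b, φ ≠ .cbar b) : KillsCbar (fld φ) := fun legs b hb => by
  by_contra hne
  obtain ⟨p, rfl⟩ := eq_of_fld_ne_zero hne
  simp only [List.mem_singleton, Prod.mk.injEq] at hb
  exact h b hb.1.symm

theorem fA (a : Fin 3) (μ : Fin 4) : KillsCbar (fA a μ) := fld (by simp)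

theorem fc (a : Fin 3) : KillsCbar (fc a) := fld (by simp)

/-- The derivative multiplies by the momentum of the only leg, which is zero. This is the one way in
which an operator containing `c̄` kills the leg by itself. -/
theorem der_fcb (μ : Fin 4) (a : Fin 3) : KillsCbar (YangMills.der μ (fcb a)) :=
  fun legs b hb => by
    by_cases hne : fcb a legs = 0
    · simp [YangMills.der, hne]
    · obtain ⟨p, rfl⟩ := eq_of_fld_ne_zero hne
      simp only [List.mem_singleton, Prod.mk.injEq] at hb
      simp [YangMills.der, total, ← hb.2, num]

theorem psi (g : ℝ) (r : BareConstants) (a : Fin 3) (μ : Fin 4) : KillsCbar (psi g r a μ) :=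
  (((fc a).der μ).smul _).add
    (sum fun b => sum fun s => ((fA b μ).opMul (fc s)).smul _)

theorem Omega (g : ℝ) (r : BareConstants) (d : Fin 3) : KillsCbar (Omega g r d) :=
  sum fun a => sum fun b => ((fc a).opMul (fc b)).smul _

theorem QrhoGamma (g Λ₀ : ℝ) (r : BareConstants) (a : Fin 3) (μ : Fin 4) :
    KillsCbar (QrhoGamma g Λ₀ r a μ) :=
  ((sum fun b => sum fun s => (((psi g r b μ).conv _).opMul (fc s)).smul _).add
    (sum fun b => sum fun s => (((fc s).opMul (((fc b).der μ).conv _)).sub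
      (((fc s).opMul ((fc b).der μ)).conv _)).smul _)).add
    (sum fun s => sum fun _ => sum fun b => sum fun t =>
      (((((fA b μ).opMul (fc t)).conv _).opMul (fc s)).sub
        ((fA b μ).opMul (((fc t).opMul (fc s)).conv _))).smul _)

theorem QrhoOmega (g Λ₀ : ℝ) (r : BareConstants) (a : Fin 3) :
    KillsCbar (QrhoOmega g Λ₀ r a) :=
  sum fun s => ((fc s).opMul (((fc a).opMul (fc s)).conv _)).smul _

end KillsCbar

/-! ### The bare Lagrangian with an antighost leg at momentum zero -/

/-- `∑ c̄^b c^b c̄^a c^a` -/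
def monGhost4 : Op := ∑ a, ∑ b, opMul (opMul (opMul (fcb b) (fc b)) (fcb a)) (fc a)
/-- `∑ c̄^b c^b A^a_μ A^a_μ` -/
def monGhostAA1 : Op :=
  ∑ a, ∑ b, ∑ μ, opMul (opMul (opMul (fcb b) (fc b)) (fA a μ)) (fA a μ)
/-- `∑ c̄^a c^b A^a_μ A^b_μ` -/
def monGhostAA2 : Op :=
  ∑ a, ∑ b, ∑ μ, opMul (opMul (opMul (fcb a) (fc b)) (fA a μ)) (fA b μ)
/-- `∑ ε_{abd} c̄^a A^b_μ ∂_μ c^d` -/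
def monGhostA : Op :=
  ∑ a, ∑ b, ∑ d, ∑ μ, num (eps a b d) • opMul (opMul (fcb a) (fA b μ)) (der μ (fc d))
/-- `∑ c̄^a ∂² c^a` -/
def monKin : Op := ∑ a, opMul (fcb a) (lap (fc a))
/-- `∑ c̄^a c^a` -/
def monMass : Op := ∑ a, opMul (fcb a) (fc a)

theorem KillsCbar.lagr0 (g : ℝ) : KillsCbar (lagr0 g) := by
  unfold YangMills.lagr0
  refine .sub (.add ?_ ?_) ?_
  · exact .sum fun a => .sum fun b => .sum fun c => .sum fun μ => .sum fun ν =>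
      .smul _ (.opMul (.opMul (.der _ (.fA _ _)) (.fA _ _)) (.fA _ _))
  · exact .sum fun _ => .sum fun _ => .sum fun _ => .sum fun _ => .sum fun _ =>
      .sum fun _ => .sum fun _ =>
      .smul _ (.opMul (.opMul (.opMul (.fA _ _) (.fA _ _)) (.fA _ _)) (.fA _ _))
  · exact .sum fun _ => .sum fun _ => .sum fun _ => .sum fun _ =>
      .smul _ (.opMul (.opMul (.der_fcb _ _) (.fA _ _)) (.fc _))

/-- The remaining terms either contain no antighost or contain it as `∂c̄`; what survives are the
monomials with an undifferentiated `c̄`. -/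
theorem lagr_apply (ξ g : ℝ) (r : BareConstants) {legs : List Leg} {b : Fin 3}
    (hb : (Lab.cbar b, (0 : Mom)) ∈ legs) :
    lagr ξ g r legs = r.rcbccbc * monGhost4 legs + r.rcbcAA1 * monGhostAA1 legs
      + r.rcbcAA2 * monGhostAA2 legs - r.rAcbc2 * monGhostA legs
      + r.Scbc * monKin legs - r.mcbc * monMass legs := by
  have h1 : ∀ z : ℂ⟦X⟧, (∑ a, ∑ b, ∑ μ, ∑ ν,
      z • opMul (opMul (opMul (fA b μ) (fA b ν)) (fA a μ)) (fA a ν)) legs = 0 := fun z =>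
    KillsCbar.sum (fun _ => .sum fun _ => .sum fun _ => .sum fun _ =>
        .smul _ (.opMul (.opMul (.opMul (.fA _ _) (.fA _ _)) (.fA _ _)) (.fA _ _))) legs b hb
  have h2 : ∀ z : ℂ⟦X⟧, (∑ a, ∑ b, ∑ μ, ∑ ν,
      z • opMul (opMul (opMul (fA b ν) (fA b ν)) (fA a μ)) (fA a μ)) legs = 0 := fun z =>
    KillsCbar.sum (fun _ => .sum fun _ => .sum fun _ => .sum fun _ =>
        .smul _ (.opMul (.opMul (.opMul (.fA _ _) (.fA _ _)) (.fA _ _)) (.fA _ _))) legs b hb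
  have h3 : ∀ z : ℂ⟦X⟧, (∑ a, ∑ b, ∑ c, ∑ μ, ∑ ν, (num (2 * eps a b c) * z) •
      opMul (opMul (der μ (fA a ν)) (fA b μ)) (fA c ν)) legs = 0 := fun z =>
    KillsCbar.sum (fun _ => .sum fun _ => .sum fun _ => .sum fun _ => .sum fun _ =>
        .smul _ (.opMul (.opMul (.der _ (.fA _ _)) (.fA _ _)) (.fA _ _))) legs b hb
  have h4 : ∀ z : ℂ⟦X⟧, (∑ a, ∑ b, ∑ d, ∑ μ, (num (eps a b d) * z) •
      opMul (opMul (der μ (fcb a)) (fA b μ)) (fc d)) legs = 0 := fun z =>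
    KillsCbar.sum (fun _ => .sum fun _ => .sum fun _ => .sum fun _ =>
        .smul _ (.opMul (.opMul (.der_fcb _ _) (.fA _ _)) (.fc _))) legs b hb
  have h5 : ∀ z : ℂ⟦X⟧, (∑ a, ∑ μ, ∑ ν, z •
      opMul (fA a μ) ((if μ = ν then lap (fA a ν) else 0) - der μ (der ν (fA a ν)))) legs = 0 :=
    fun z => KillsCbar.sum (fun _ => .sum fun _ => .sum fun _ => .smul _ (.opMul (.fA _ _)
      (.sub (by split_ifs; exacts [.lap (.fA _ _), .zero]) (.der _ (.der _ (.fA _ _))))))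
      legs b hb
  have h6 : ∀ z : ℂ⟦X⟧, (∑ a, ∑ μ, ∑ ν, z •
      opMul (der μ (fA a μ)) (der ν (fA a ν))) legs = 0 :=
    fun z => KillsCbar.sum (fun _ => .sum fun _ => .sum fun _ => .smul _
      (.opMul (.der _ (.fA _ _)) (.der _ (.fA _ _)))) legs b hb
  have h7 : ∀ z : ℂ⟦X⟧, (∑ a, ∑ μ, z • opMul (fA a μ) (fA a μ)) legs = 0 :=
    fun z => KillsCbar.sum (fun _ => .sum fun _ => .smul _ (.opMul (.fA _ _) (.fA _ _))) legs b hb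
  simp only [lagr, lagrCt, Pi.add_apply, Pi.sub_apply, KillsCbar.lagr0 g legs b hb,
    h1, h2, h3, h4, h5, h6, h7]
  simp only [monGhost4, monGhostAA1, monGhostAA2, monGhostA, monKin, monMass,
    Finset.sum_apply, Pi.smul_apply, smul_eq_mul, Finset.mul_sum, zero_add, add_zero, sub_zero,
    mul_comm (num _) r.rAcbc2, mul_assoc]

/-- On pure field legs, the sources do not contribute to the bare Lagrangian. -/
theorem lagrAux_apply_of_isField (ξ g Λ₀ : ℝ) (r : BareConstants) {legs : List Leg}
    (h : ∀ x ∈ legs, x.1.IsField) : lagrAux ξ g Λ₀ r legs = lagr ξ g r legs := by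
  have key : ∀ {φ : Lab}, ¬ φ.IsField → ∀ x ∈ legs, x.1 ≠ φ :=
    fun hφ x hx he => hφ (he ▸ h x hx)
  have key2 : ∀ {φ : Lab} {G H : Op}, ¬ φ.IsField →
      opMul (opMul (fld φ) G) H legs = 0 := fun hφ => opMul_eq_zero fun ys zs hp =>
    Or.inl (opMul_fld_eq_zero fun x hx => key hφ x (hp.subset (List.mem_append_left _ hx)))
  simp only [lagrAux, Pi.add_apply, Finset.sum_apply]
  simp [opMul_fld_eq_zero (key (φ := .gamma _ _) id), opMul_fld_eq_zero (key (φ := .omega _) id),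
    opMul_fld_eq_zero (key (φ := .beta _) id), opMul_fld_eq_zero (key (φ := .rho) id),
    key2 (φ := .rho) id]

/-- Without insertions of `β` and `ρ`, and with an antighost leg at momentum zero,
the sources do not contribute to the bare Lagrangian. -/
theorem lagrAux_apply_of_cbar (ξ g Λ₀ : ℝ) (r : BareConstants) {legs : List Leg}
    (h : ∀ x ∈ legs, x.1.IsField ∨ x.1.IsKappa) {b : Fin 3}
    (hb : (Lab.cbar b, (0 : Mom)) ∈ legs) : lagrAux ξ g Λ₀ r legs = lagr ξ g r legs := by
  have key : ∀ {φ : Lab}, ¬ (φ.IsField ∨ φ.IsKappa) → ∀ x ∈ legs, x.1 ≠ φ :=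
    fun hφ x hx he => hφ (he ▸ h x hx)
  have key2 : ∀ {φ : Lab} {G H : Op}, ¬ (φ.IsField ∨ φ.IsKappa) →
      opMul (opMul (fld φ) G) H legs = 0 := fun hφ => opMul_eq_zero fun ys zs hp =>
    Or.inl (opMul_fld_eq_zero fun x hx => key hφ x (hp.subset (List.mem_append_left _ hx)))
  have hg : ∀ a μ, opMul (fld (.gamma a μ)) (psi g r a μ) legs = 0 := fun a μ =>
    KillsCbar.opMul (.fld (by simp)) (.psi g r a μ) legs b hb
  have ho : ∀ a, opMul (fld (.omega a)) (Omega g r a) legs = 0 := fun a =>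
    KillsCbar.opMul (.fld (by simp)) (.Omega g r a) legs b hb
  have hbeta : ∀ a, ¬ ((Lab.beta a).IsField ∨ (Lab.beta a).IsKappa) := fun a => by
    simp [Lab.IsField, Lab.IsKappa]
  have hrho : ¬ (Lab.rho.IsField ∨ Lab.rho.IsKappa) := by
    simp [Lab.IsField, Lab.IsKappa]
  simp only [lagrAux, Pi.add_apply, Finset.sum_apply]
  simp [hg, ho, opMul_fld_eq_zero (key (hbeta _)), opMul_fld_eq_zero (key hrho), key2 hrho]

theorem total_append (ys zs : List Leg) : total (ys ++ zs) = total ys + total zs := by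
  simp [total]

theorem total_perm {ys zs : List Leg} (h : ys.Perm zs) : total ys = total zs :=
  (h.map Prod.snd).sum_eq

theorem lap_fc_apply_eq_zero {a : Fin 3} {legs : List Leg} (h : total legs = 0) :
    lap (fc a) legs = 0 := by
  simp [lap, der, h, num]

/-- With `c̄` at momentum zero, momentum conservation leaves momentum zero for `∂²c`. -/
theorem monKin_apply_eq_zero {legs : List Leg} {b : Fin 3}
    (hb : (Lab.cbar b, (0 : Mom)) ∈ legs) (h0 : total legs = 0) : monKin legs = 0 := by
  rw [monKin, Finset.sum_apply]
  refine Finset.sum_eq_zero fun a _ => opMul_eq_zero fun ys zs hp => ?_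
  rcases List.mem_append.1 (hp.symm.subset hb) with h | h
  · by_cases hy : fcb a ys = 0
    · exact Or.inl hy
    · obtain ⟨p, rfl⟩ := eq_of_fld_ne_zero hy
      simp only [List.mem_singleton, Prod.mk.injEq] at h
      have := total_perm hp
      rw [total_append, h0] at this
      exact Or.inr (lap_fc_apply_eq_zero (by simpa [total, ← h.2] using this))
  · exact Or.inr (KillsCbar.lap (.fc a) zs b h)

/-- The full bare Lagrangian vanishes on legs of total momentum zero, an antighost leg among them
and the `ρ` legs having momentum zero, if the relevant counterterms vanish. -/
theorem lagrAux_eq_zero (ξ g Λ₀ : ℝ) (r : BareConstants)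
    (h1 : r.rcbccbc = 0) (h2 : r.rcbcAA1 = 0) (h3 : r.rcbcAA2 = 0) (h4 : r.rAcbc2 = 0)
    (h5 : r.mcbc = 0) {legs : List Leg} {b : Fin 3}
    (hb : (Lab.cbar b, (0 : Mom)) ∈ legs) (h0 : total legs = 0)
    (hrho : ∀ x ∈ legs, x.1 = .rho → x.2 = 0) : lagrAux ξ g Λ₀ r legs = 0 := by
  have hL : ∀ {legs : List Leg} {b : Fin 3}, (Lab.cbar b, (0 : Mom)) ∈ legs → total legs = 0 →
      lagr ξ g r legs = 0 := fun hb h0 => by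
    rw [lagr_apply ξ g r hb, h1, h2, h3, h4, h5, monKin_apply_eq_zero hb h0]
    simp
  -- The leg appended by `funcDeriv` restores total momentum zero, so `hL` applies without any
  -- condition on the momenta of the other legs.
  have hD : ∀ φ, KillsCbar (funcDeriv φ (lagr ξ g r)) := fun φ legs b hb =>
    hL (List.mem_append_left _ hb) (by simp [total])
  have hQ : ∀ {zs : List Leg} {b : Fin 3}, (Lab.cbar b, (0 : Mom)) ∈ zs → total zs = 0 →
      Qrho ξ g Λ₀ r zs = 0 := by
    intro zs b hb h0
    have t1 : KillsCbar (∑ a, ∑ μ,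
        opMul (funcDeriv (.A a μ) (lagr ξ g r)) (smear Λ₀ (psi g r a μ))) :=
      .sum fun a => .sum fun μ => .opMul (hD _) (.conv _ (.psi g r a μ))
    have t2 : KillsCbar (∑ a,
        opMul (funcDeriv (.c a) (lagr ξ g r)) (smear Λ₀ (Omega g r a))) :=
      .sum fun a => .opMul (hD _) (.conv _ (.Omega g r a))
    have t3 : KillsCbar (∑ a, ∑ μ, num (1 / ξ) •
        opMul (funcDeriv (.cbar a) (lagr ξ g r)) (smear Λ₀ (der μ (fA a μ)))) :=
      .sum fun a => .sum fun μ => .smul _ (.opMul (hD _) (.conv _ (.der _ (.fA a μ))))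
    have t4 : KillsCbar (∑ a, ∑ μ, opMul (fA a μ) (invC ξ (psi g r a) μ)) :=
      .sum fun a => .sum fun μ => .opMul (.fA a μ) (.sum fun ν => .conv _ (.psi g r a ν))
    have t6 : KillsCbar (∑ a, ∑ μ, num (1 / ξ) • opMul (der μ (fA a μ)) (invS (fc a))) :=
      .sum fun a => .sum fun μ => .smul _ (.opMul (.der _ (.fA a μ)) (.conv _ (.fc a)))
    -- The only term of `Q_ρ` with an explicit undifferentiated `c̄`. Here `Ω` receives total
    -- momentum zero and `S⁻¹(0) = 0`; this is why `ρ` must be integrated.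
    have t5 : ∀ a, opMul (fcb a) (invS (Omega g r a)) zs = 0 := fun a =>
      opMul_eq_zero fun us vs hp => by
        rcases List.mem_append.1 (hp.symm.subset hb) with h | h
        · by_cases hy : fcb a us = 0
          · exact Or.inl hy
          · obtain ⟨p, rfl⟩ := eq_of_fld_ne_zero hy
            simp only [List.mem_singleton, Prod.mk.injEq] at h
            have := total_perm hp
            rw [total_append, h0] at this
            have hv : total vs = 0 := by simpa [total, ← h.2] using this
            exact Or.inr (by simp [invS, conv, hv, num])
        · exact Or.inr (KillsCbar.conv _ (.Omega g r a) vs b h)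
    rw [Qrho]
    simp only [Pi.add_apply, Pi.sub_apply, t1 zs b hb, t2 zs b hb, t3 zs b hb, t4 zs b hb,
      t6 zs b hb]
    simp [t5]
  have a1 : KillsCbar (∑ a, ∑ μ, opMul (fld (.gamma a μ)) (psi g r a μ)) :=
    .sum fun a => .sum fun μ => .opMul (.fld (by simp)) (.psi g r a μ)
  have a2 : KillsCbar (∑ a, opMul (fld (.omega a)) (Omega g r a)) :=
    .sum fun a => .opMul (.fld (by simp)) (.Omega g r a)
  have a4 : KillsCbar (∑ a, ∑ μ,
      opMul (opMul (fld .rho) (fld (.gamma a μ))) (QrhoGamma g Λ₀ r a μ)) :=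
    .sum fun a => .sum fun μ =>
      .opMul (.opMul (.fld (by simp)) (.fld (by simp))) (.QrhoGamma g Λ₀ r a μ)
  have a5 : KillsCbar (∑ a,
      opMul (opMul (fld .rho) (fld (.omega a))) (QrhoOmega g Λ₀ r a)) :=
    .sum fun a =>
      .opMul (.opMul (.fld (by simp)) (.fld (by simp))) (.QrhoOmega g Λ₀ r a)
  have a6 : KillsCbar (∑ a, opMul (fld (.beta a)) (Qbeta ξ g Λ₀ r a)) :=
    .sum fun a => .opMul (.fld (by simp))
      (.sub (.conv _ (.sub (hD _) (.sum fun μ => .der _ (.psi g r a μ)))) (.conv _ (.fc a)))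
  -- The leg taken by `ρ` has momentum zero, so the legs left for `Q_ρ` again have total momentum
  -- zero and include the antighost.
  have a3 : opMul (fld .rho) (Qrho ξ g Λ₀ r) legs = 0 := opMul_eq_zero fun ys zs hp => by
    by_cases hy : fld .rho ys = 0
    · exact Or.inl hy
    · obtain ⟨p, rfl⟩ := eq_of_fld_ne_zero hy
      have hp0 : p = 0 := hrho (.rho, p) (hp.subset (by simp)) rfl
      have ht := total_perm hp
      rw [total_append, h0] at ht
      have hm := hp.symm.subset hb
      simp only [List.mem_append, List.mem_singleton, Prod.mk.injEq, reduceCtorEq, false_and,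
        false_or] at hm
      exact Or.inr (hQ hm (by simpa [total, hp0] using ht))
  simp only [lagrAux, Pi.add_apply, hL hb h0, a1 legs b hb, a2 legs b hb, a3, a4 legs b hb,
    a5 legs b hb, a6 legs b hb, add_zero]


theorem monKin_apply_of_length {legs : List Leg} (h : legs.length ≠ 2) : monKin legs = 0 := by
  rw [monKin, Finset.sum_apply]
  refine Finset.sum_eq_zero fun a _ => opMul_eq_zero fun ys zs hp => ?_
  by_contra! hne
  obtain ⟨p, rfl⟩ := eq_of_fld_ne_zero hne.1
  have hz : fc a zs ≠ 0 := fun h0 => hne.2 (by simp [lap, der, h0])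
  obtain ⟨q, rfl⟩ := eq_of_fld_ne_zero hz
  exact h hp.length_eq.symm

theorem monMass_apply_of_length {legs : List Leg} (h : legs.length ≠ 2) : monMass legs = 0 := by
  rw [monMass, Finset.sum_apply]
  refine Finset.sum_eq_zero fun a _ => opMul_eq_zero fun ys zs hp => ?_
  by_contra! hne
  obtain ⟨p, rfl⟩ := eq_of_fld_ne_zero hne.1
  obtain ⟨q, rfl⟩ := eq_of_fld_ne_zero hne.2
  exact h hp.length_eq.symm

theorem coeff_mul_eq_zero {r : ℂ⟦X⟧} {l : ℕ} (h : ∀ j ≤ l, PowerSeries.coeff j r = 0)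
    (x : ℂ⟦X⟧) : PowerSeries.coeff l (r * x) = 0 := by
  rw [PowerSeries.coeff_mul]
  refine Finset.sum_eq_zero fun ij hij => ?_
  rw [h _ (Finset.HasAntidiagonal.mem_antidiagonal.1 hij ▸ Nat.le_add_right _ _), zero_mul]

/-! ### The flow of vertex functions with an antighost leg at momentum zero -/

instance : DecidablePred Lab.IsField := fun φ => by
  cases φ <;> unfold Lab.IsField <;> infer_instance

/-- The number of field legs. -/
def fieldCount (legs : List Leg) : ℕ := legs.countP fun x => x.1.IsField

theorem fieldCount_le_length (legs : List Leg) : fieldCount legs ≤ legs.length :=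
  List.countP_le_length

/-- Legs of total momentum zero with the property `P`, one of them
an antighost at momentum zero. -/
def IsAntighostConfig (P : Leg → Prop) (legs : List Leg) : Prop :=
  (∀ x ∈ legs, P x) ∧ total legs = 0 ∧ ∃ b, (Lab.cbar b, (0 : Mom)) ∈ legs

theorem sum_map_filter_eq {ι M : Type*} [AddCommMonoid M] (p : ι → Prop) [DecidablePred p]
    (g : ι → M) (s : List ι) :
    ((s.filter p).map g).sum = (s.map fun i => if p i then g i else 0).sum := by
  induction s with
  | nil => rfl
  | cons i s ih => by_cases h : p i <;> simp [h, ih]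

theorem total_part {m : ℕ} (legs : List Leg) (f : Fin legs.length → Fin m) (j : Fin m) :
    total (part legs f j) = ∑ i, if f i = j then (legs.get i).2 else 0 := by
  rw [Fin.sum_univ_def, ← sum_map_filter_eq (fun i => f i = j)]
  simp [total, part, Function.comp_def]

/-- Momentum conservation at the `j`-th vertex: the outgoing internal line carries what came in plus
the external momenta attached there. Hence every vertex of a chain has total momentum zero. -/
theorem lineMom_succ {m : ℕ} (legs : List Leg) (f : Fin legs.length → Fin m) (k : Mom)
    (j : Fin m) : lineMom legs f k (j + 1) = lineMom legs f k j + total (part legs f j) := by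
  rw [total_part, lineMom, lineMom, add_assoc, ← Finset.sum_add_distrib]
  congr 1
  refine Finset.sum_congr rfl fun i _ => ?_
  rcases lt_trichotomy (f i) j with h | h | h
  · have h' : (f i : ℕ) < j := h
    simp [h.ne, h', Nat.lt_succ_of_lt h']
  · simp [h]
  · have h' : (j : ℕ) < f i := h
    simp [h.ne', Nat.not_lt.2 h'.le, show ¬ ((f i : ℕ) < j + 1) by omega]

theorem covar_eq_zero_left (ξ Λ Λ₀ : ℝ) {φ : Lab} (h : ¬ φ.IsField) (φ' : Lab) (p : Mom) :
    covar ξ Λ Λ₀ φ φ' p = 0 := by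
  cases φ <;> first | rfl | exact absurd trivial h

theorem covar_eq_zero_right (ξ Λ Λ₀ : ℝ) (φ : Lab) {φ' : Lab} (h : ¬ φ'.IsField) (p : Mom) :
    covar ξ Λ Λ₀ φ φ' p = 0 := by
  cases φ' <;> first | exact absurd trivial h | (cases φ <;> rfl)

theorem covarDot_eq_zero (ξ Λ Λ₀ : ℝ) {φ φ' : Lab} (h : ¬ φ.IsField ∨ ¬ φ'.IsField) (p : Mom) :
    covarDot ξ Λ Λ₀ φ φ' p = 0 := by
  have h0 : (fun t : ℝ => covar ξ t Λ₀ φ φ' p) = fun _ => 0 := by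
    funext t
    rcases h with h | h
    · exact covar_eq_zero_left ξ t Λ₀ h φ' p
    · exact covar_eq_zero_right ξ t Λ₀ φ h p
  rw [covarDot, h0, deriv_const, mul_zero]

/-- In a chain, the external antighost leg at momentum zero sits at a vertex with two
internal field legs. -/
theorem flowRhs_eq_zero (ξ Λ₀ : ℝ) {P : Leg → Prop} (hP : ∀ x : Leg, x.1.IsField → P x)
    {W : ℕ → ℝ → List Leg → ℂ} {l : ℕ} {Λ : ℝ}
    (hW : ∀ j ≤ l, ∀ legs, IsAntighostConfig P legs → 3 ≤ fieldCount legs → W j Λ legs = 0)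
    {legs : List Leg} (hlegs : IsAntighostConfig P legs) : flowRhs ξ Λ₀ W l Λ legs = 0 := by
  obtain ⟨hPl, -, b, hb⟩ := hlegs
  obtain ⟨i₀, hi₀⟩ := List.get_of_mem hb
  suffices h : ∀ k, loopIntegrand ξ Λ₀ W l Λ legs k = 0 by simp [flowRhs, h]
  intro k
  refine Finset.sum_eq_zero fun m _ => Finset.sum_eq_zero fun f _ =>
    Finset.sum_eq_zero fun ν hν => Finset.sum_eq_zero fun ζ _ => Finset.sum_eq_zero fun ζ' _ => ?_
  by_cases hζ : (ζ (f i₀)).IsField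
  · by_cases hζ' : (ζ' (f i₀)).IsField
    -- Both internal lines at the vertex of the antighost are fields: this factor of the chain
    -- vanishes by `hW`.
    · rw [chain, Finset.prod_eq_zero (Finset.mem_univ (f i₀)), zero_mul, mul_zero]
      have hmem : (Lab.cbar b, (0 : Mom)) ∈ part legs f (f i₀) :=
        List.mem_map.2 ⟨i₀, by simp, hi₀⟩
      refine hW _ ?_ _ ⟨?_, ?_, b, by simp [hmem]⟩ ?_
      · rw [Finset.Nat.mem_antidiagonalTuple] at hν
        rw [← hν]
        exact Finset.single_le_sum (f := ν) (fun _ _ => Nat.zero_le _) (Finset.mem_univ _)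
      · intro x hx
        simp only [List.mem_cons, List.mem_append, List.not_mem_nil, or_false] at hx
        rcases hx with rfl | hx | rfl
        · exact hP _ hζ
        · obtain ⟨i, -, rfl⟩ := List.mem_map.1 hx
          exact hPl _ (legs.get_mem i)
        · exact hP _ hζ'
      · rw [lineMom_succ]
        simp [total]
      · have h1 : 0 < (part legs f (f i₀)).countP fun x => x.1.IsField :=
          List.countP_pos_iff.2 ⟨_, hmem, decide_eq_true trivial⟩
        rw [fieldCount, List.countP_cons_of_pos (by exact decide_eq_true hζ), List.countP_append,
          List.countP_cons_of_pos (by exact decide_eq_true hζ')]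
        omega
    -- A source on the right line of this vertex kills the propagator of that line: the
    -- differentiated one, closing the loop, if the vertex is the last of the chain, and an ordinary
    -- one otherwise. The left line is treated alike below.
    · induction h : f i₀ using Fin.lastCases with
      | last =>
        rw [covarDot_eq_zero _ _ _ (Or.inr (h ▸ hζ'))]
        simp
      | cast j =>
        rw [chain, Finset.prod_eq_zero (s := Finset.univ)
          (f := fun j : Fin m => (covar ξ Λ Λ₀ _ _ _ : ℂ)) (Finset.mem_univ j)]
        · simp
        · rw [covar_eq_zero_right _ _ _ _ (h ▸ hζ'), Complex.ofReal_zero]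
  · induction h : f i₀ using Fin.cases with
    | zero =>
      rw [covarDot_eq_zero _ _ _ (Or.inl (h ▸ hζ))]
      simp
    | succ j =>
      rw [chain, Finset.prod_eq_zero (s := Finset.univ)
        (f := fun j : Fin m => (covar ξ Λ Λ₀ _ _ _ : ℂ)) (Finset.mem_univ j)]
      · simp
      · rw [covar_eq_zero_left _ _ _ (h ▸ hζ), Complex.ofReal_zero]

/-- As long as the vertex functions with at least three field legs vanish in lower loop orders,
there is no flow. -/
theorem vertex_eq_coeff (ξ g Λ₀ : ℝ) (r : BareConstants) {P : Leg → Prop}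
    (hP : ∀ x : Leg, x.1.IsField → P x) {l : ℕ}
    (h : ∀ j < l, ∀ Λ, 0 < Λ → Λ ≤ Λ₀ → ∀ legs, IsAntighostConfig P legs →
      3 ≤ fieldCount legs → vertex ξ g Λ₀ r j Λ legs = 0)
    {Λ : ℝ} (hΛ : 0 < Λ) (hΛ₀ : Λ ≤ Λ₀) {legs : List Leg} (hlegs : IsAntighostConfig P legs) :
    vertex ξ g Λ₀ r l Λ legs = PowerSeries.coeff l (lagrAux ξ g Λ₀ r legs) := by
  cases l with
  | zero => exact vertex_zero ..
  | succ l =>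
    rw [vertex_succ, intervalIntegral.integral_congr (g := fun _ => 0)]
    · simp
    · intro t ht
      rw [Set.uIcc_of_le hΛ₀] at ht
      exact flowRhs_eq_zero ξ Λ₀ hP
        (fun j hj => h j (Nat.lt_succ_of_le hj) t (hΛ.trans_le ht.1) ht.2) hlegs

/-! ### The marginal counterterms -/

/-- The summands with `(a, b) = (0, 1)` and `(1, 0)` contribute equally, as the bilinears `c̄^a c^a`
commute. -/
theorem monGhost4_apply :
    monGhost4 [(.c 0, 0), (.cbar 0, 0), (.c 1, 0), (.cbar 1, 0)] = 1 + 1 := by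
  simp [monGhost4, Finset.sum_apply, Fin.sum_univ_three, opMul, fcb, fc, fld, oddCount, Lab.odd]

theorem monGhostAA1_apply :
    monGhostAA1 [(.c 0, 0), (.cbar 0, 0), (.A 1 0, 0), (.A 1 0, 0)] = 1 + 1 := by
  simp [monGhostAA1, Finset.sum_apply, Fin.sum_univ_three, Fin.sum_univ_four, opMul, fcb, fc, fA,
    fld, oddCount, Lab.odd]

/-- Colour separates the two `c̄cAA` structures. Here the ghosts force `a = b = 0` while both gluons
have colour `1`; with ghosts of different colours, as in the next two lemmas, only the second
structure survives. -/
theorem monGhostAA2_apply_self :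
    monGhostAA2 [(.c 0, 0), (.cbar 0, 0), (.A 1 0, 0), (.A 1 0, 0)] = 0 := by
  simp [monGhostAA2, Finset.sum_apply, Fin.sum_univ_three, Fin.sum_univ_four, opMul, fcb, fc, fA,
    fld, oddCount, Lab.odd]

theorem monGhostAA1_apply_of_ne :
    monGhostAA1 [(.c 0, 0), (.cbar 1, 0), (.A 0 0, 0), (.A 1 0, 0)] = 0 := by
  simp [monGhostAA1, Finset.sum_apply, Fin.sum_univ_three, Fin.sum_univ_four, opMul, fcb, fc, fA,
    fld, oddCount, Lab.odd]

theorem monGhostAA2_apply :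
    monGhostAA2 [(.c 0, 0), (.cbar 1, 0), (.A 0 0, 0), (.A 1 0, 0)] = 1 := by
  simp [monGhostAA2, Finset.sum_apply, Fin.sum_univ_three, Fin.sum_univ_four, opMul, fcb, fc, fA,
    fld, oddCount, Lab.odd]

/-- With `ε₀₁₂ = 1`, the derivative acts on `c` of momentum `-t e₀` and yields `-i · (-t)`. -/
theorem monGhostA_apply (t : ℝ) :
    monGhostA [(.c 2, t • (-EuclideanSpace.single 0 1)), (.cbar 0, 0),
      (.A 1 0, t • EuclideanSpace.single 0 1)] = num (Complex.I * t) := by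
  simp [monGhostA, Finset.sum_apply, Fin.sum_univ_three, Fin.sum_univ_four, opMul, fcb, fc, fA,
    fld, oddCount, Lab.odd, der, total, eps]
  simp [num]

theorem monMass_apply : monMass [(.c 0, 0), (.cbar 0, 0)] = 1 := by
  simp [monMass, Finset.sum_apply, opMul, fcb, fc, fld, oddCount, Lab.odd]

theorem monGhostAA_apply_ghosts :
    monGhostAA1 [(.c 0, 0), (.cbar 0, 0), (.c 1, 0), (.cbar 1, 0)] = 0 ∧
    monGhostAA2 [(.c 0, 0), (.cbar 0, 0), (.c 1, 0), (.cbar 1, 0)] = 0 ∧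
    monGhostA [(.c 0, 0), (.cbar 0, 0), (.c 1, 0), (.cbar 1, 0)] = 0 := by
  simp [monGhostAA1, monGhostAA2, monGhostA, Finset.sum_apply, opMul, fcb, fc, fA, fld, der]

theorem monGhost_apply_AA (a b : Fin 3) (d e : Fin 3) :
    monGhost4 [(.c a, 0), (.cbar b, 0), (.A d 0, 0), (.A e 0, 0)] = 0 ∧
    monGhostA [(.c a, 0), (.cbar b, 0), (.A d 0, 0), (.A e 0, 0)] = 0 := by
  simp [monGhost4, monGhostA, Finset.sum_apply, opMul, fcb, fc, fA, fld, der]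

theorem monGhost_apply_A (a b d : Fin 3) (p q q' : Mom) :
    monGhost4 [(.c a, p), (.cbar b, q), (.A d 0, q')] = 0 ∧
    monGhostAA1 [(.c a, p), (.cbar b, q), (.A d 0, q')] = 0 ∧
    monGhostAA2 [(.c a, p), (.cbar b, q), (.A d 0, q')] = 0 := by
  simp [monGhost4, monGhostAA1, monGhostAA2, Finset.sum_apply, opMul, fcb, fc, fA, fld]

theorem mon_apply_two (a b : Fin 3) :
    monGhost4 [(.c a, 0), (.cbar b, 0)] = 0 ∧ monGhostAA1 [(.c a, 0), (.cbar b, 0)] = 0 ∧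
    monGhostAA2 [(.c a, 0), (.cbar b, 0)] = 0 ∧ monGhostA [(.c a, 0), (.cbar b, 0)] = 0 ∧
    monKin [(.c a, 0), (.cbar b, 0)] = 0 := by
  refine ⟨?_, ?_, ?_, ?_, monKin_apply_eq_zero (b := b) (by simp) (by simp [total])⟩ <;>
  simp [monGhost4, monGhostAA1, monGhostAA2, monGhostA, Finset.sum_apply, opMul, fcb, fc, fA, fld,
    der]

theorem ofFn_line (φ φ' φ'' : Lab) (e : Mom) (t : ℝ) :
    (List.ofFn fun i => (![φ, φ', φ''] i, ((0 : Fin 3 → Mom) +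
      t • ((Pi.single 2 e : Fin 3 → Mom) - (Pi.single 0 e : Fin 3 → Mom))) i))
      = [(φ, t • -e), (φ', 0), (φ'', t • e)] := by
  simp [List.ofFn_succ, Pi.single_apply]

/-- A leg which is a field or a source `γ`, `ω`. -/
def Leg.IsFieldOrKappa (x : Leg) : Prop := x.1.IsField ∨ x.1.IsKappa

/-- Vanishing of the marginal counterterms which break the antighost equation, in order `ħ^l`. -/
def MarginalCoeffsVanish (r : BareConstants) (l : ℕ) : Prop :=
  PowerSeries.coeff l r.rcbcAA1 = 0 ∧ PowerSeries.coeff l r.rcbccbc = 0 ∧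
    PowerSeries.coeff l r.rcbcAA2 = 0 ∧ PowerSeries.coeff l r.rAcbc2 = 0

/-- If vertex functions at `M` equal their bare values, each marginal condition, taken at suitable
colours, is a nonzero multiple of a single counterterm coefficient. -/
theorem marginalCoeffsVanish_of_bare {ξ g Λ₀ M : ℝ} {r : BareConstants} {l : ℕ}
    (hyp : MarginalConditions ξ g Λ₀ M r)
    (h : ∀ legs, IsAntighostConfig Leg.IsFieldOrKappa legs →
      vertex ξ g Λ₀ r l M legs = PowerSeries.coeff l (lagrAux ξ g Λ₀ r legs)) :
    MarginalCoeffsVanish r l := by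
  have hlagr : ∀ (legs : List Leg) (b : Fin 3), (∀ x ∈ legs, x.1.IsField) →
      (Lab.cbar b, (0 : Mom)) ∈ legs → total legs = 0 →
      vertex ξ g Λ₀ r l M legs = PowerSeries.coeff l (lagr ξ g r legs) := by
    intro legs b hf hb h0
    rw [h legs ⟨fun x hx => Or.inl (hf x hx), h0, b, hb⟩, lagrAux_apply_of_isField ξ g Λ₀ r hf]
  obtain ⟨hcc, hAA, hA⟩ := hyp l
  have e1 : PowerSeries.coeff l r.rcbccbc = 0 := by
    have := hcc 0 0 1 1
    simp only [vertexFn, List.rotate_zero, List.ofFn_succ, List.ofFn_zero, Pi.zero_apply] at this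
    simp only [Fin.isValue, Matrix.cons_val_zero, Matrix.cons_val_succ] at this
    rw [hlagr _ 0 (by simp [Lab.IsField]) (by simp) (by simp [total]),
      lagr_apply ξ g r (b := 0) (by simp), monGhost4_apply, monGhostAA_apply_ghosts.1,
      monGhostAA_apply_ghosts.2.1, monGhostAA_apply_ghosts.2.2, monKin_apply_of_length (by simp),
      monMass_apply_of_length (by simp)] at this
    simpa [mul_add] using this
  have e2 : PowerSeries.coeff l r.rcbcAA1 = 0 := by
    have := hAA 0 0 1 1 0 0
    simp only [vertexFn, List.rotate_zero, List.ofFn_succ, List.ofFn_zero, Pi.zero_apply] at this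
    simp only [Fin.isValue, Matrix.cons_val_zero, Matrix.cons_val_succ] at this
    rw [hlagr _ 0 (by simp [Lab.IsField]) (by simp) (by simp [total]),
      lagr_apply ξ g r (b := 0) (by simp), monGhostAA1_apply, monGhostAA2_apply_self,
      (monGhost_apply_AA _ _ _ _).1, (monGhost_apply_AA _ _ _ _).2,
      monKin_apply_of_length (by simp), monMass_apply_of_length (by simp)] at this
    simpa [mul_add] using this
  have e3 : PowerSeries.coeff l r.rcbcAA2 = 0 := by
    have := hAA 0 1 0 1 0 0
    simp only [vertexFn, List.rotate_zero, List.ofFn_succ, List.ofFn_zero, Pi.zero_apply] at this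
    simp only [Fin.isValue, Matrix.cons_val_zero, Matrix.cons_val_succ] at this
    rw [hlagr _ 1 (by simp [Lab.IsField]) (by simp) (by simp [total]),
      lagr_apply ξ g r (b := 1) (by simp), monGhostAA1_apply_of_ne, monGhostAA2_apply,
      (monGhost_apply_AA _ _ _ _).1, (monGhost_apply_AA _ _ _ _).2,
      monKin_apply_of_length (by simp), monMass_apply_of_length (by simp)] at this
    simpa using this
  refine ⟨e2, e1, e3, ?_⟩
  -- Differentiating in the gluon momentum moves the ghost momentum oppositely and leaves the
  -- antighost at zero. Along this line the vertex function is linear in `t`, with slope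
  -- proportional to the coefficient.
  have := hA 2 0 1 0 0
  have hv : ∀ t : ℝ, vertexFn ξ g Λ₀ r l M 0 ![Lab.c 2, Lab.cbar 0, Lab.A 1 0]
      (0 + t • (Pi.single (2 : Fin 3) (EuclideanSpace.single (0 : Fin 4) (1 : ℝ) : Mom)
        - Pi.single 0 (EuclideanSpace.single 0 (1 : ℝ) : Mom)))
      = t * (-(PowerSeries.coeff l r.rAcbc2) * Complex.I) := by
    intro t
    rw [vertexFn, List.rotate_zero, ofFn_line, hlagr _ 0 (by simp [Lab.IsField]) (by simp)
      (by simp [total]), lagr_apply ξ g r (b := 0) (by simp), monGhostA_apply,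
      (monGhost_apply_A _ _ _ _ _ _).1, (monGhost_apply_A _ _ _ _ _ _).2.1,
      (monGhost_apply_A _ _ _ _ _ _).2.2, monKin_apply_of_length (by simp),
      monMass_apply_of_length (by simp)]
    simp only [mul_zero, zero_sub, add_zero, sub_zero, map_neg, num,
      PowerSeries.coeff_mul_C]
    ring
  simp only [momDeriv, lineDeriv, hv] at this
  rw [deriv_mul_const (by fun_prop)] at this
  -- Seen as a continuous linear map, the coercion from `ℝ` to `ℂ` has derivative `1`.
  change deriv (⇑Complex.ofRealCLM) 0 * _ = 0 at this
  rw [Complex.ofRealCLM.hasDerivAt.deriv] at this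
  simpa using this

/-! ### Induction on the loop order and the ghost mass counterterm -/

theorem coeff_lagrAux_eq_zero (ξ g Λ₀ : ℝ) (r : BareConstants) {l : ℕ}
    (hr : ∀ j ≤ l, MarginalCoeffsVanish r j) {legs : List Leg}
    (hlegs : IsAntighostConfig Leg.IsFieldOrKappa legs) (h3 : 3 ≤ fieldCount legs) :
    PowerSeries.coeff l (lagrAux ξ g Λ₀ r legs) = 0 := by
  obtain ⟨hP, -, b, hb⟩ := hlegs
  -- Three fields exclude the two-point monomials, whose coefficients are not controlled at this
  -- stage.
  have hlen : legs.length ≠ 2 := by have := fieldCount_le_length legs; omega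
  rw [lagrAux_apply_of_cbar ξ g Λ₀ r hP hb, lagr_apply ξ g r hb, monKin_apply_of_length hlen,
    monMass_apply_of_length hlen]
  simp only [map_add, map_sub, coeff_mul_eq_zero fun j hj => (hr j hj).1,
    coeff_mul_eq_zero fun j hj => (hr j hj).2.1, coeff_mul_eq_zero fun j hj => (hr j hj).2.2.1,
    coeff_mul_eq_zero fun j hj => (hr j hj).2.2.2]
  simp

/-- The two claims need each other: vanishing vertices below order `l` stop the flow at order `l`,
so the conditions at `M` fix the coefficients of order `l`, and these in turn give vanishing
vertices of order `l` at all scales. -/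
theorem marginalCoeffsVanish_and_vertex_eq_zero {ξ g M Λ₀ : ℝ} (hM : 0 < M) (hMΛ₀ : M ≤ Λ₀)
    {r : BareConstants} (hyp : MarginalConditions ξ g Λ₀ M r) (l : ℕ) :
    MarginalCoeffsVanish r l ∧ ∀ Λ, 0 < Λ → Λ ≤ Λ₀ → ∀ legs,
      IsAntighostConfig Leg.IsFieldOrKappa legs → 3 ≤ fieldCount legs →
        vertex ξ g Λ₀ r l Λ legs = 0 := by
  induction l using Nat.strong_induction_on with
  | _ l ih =>
    have hv : ∀ Λ, 0 < Λ → Λ ≤ Λ₀ → ∀ legs, IsAntighostConfig Leg.IsFieldOrKappa legs →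
        vertex ξ g Λ₀ r l Λ legs = PowerSeries.coeff l (lagrAux ξ g Λ₀ r legs) :=
      fun Λ h h' legs hl => vertex_eq_coeff ξ g Λ₀ r (fun x hx => Or.inl hx)
        (fun j hj => (ih j hj).2) h h' hl
    have hc := marginalCoeffsVanish_of_bare hyp (hv M hM hMΛ₀)
    refine ⟨hc, fun Λ h h' legs hl h3 => ?_⟩
    rw [hv Λ h h' legs hl]
    refine coeff_lagrAux_eq_zero ξ g Λ₀ r (fun j hj => ?_) hl h3
    rcases hj.lt_or_eq with hj | rfl
    · exact (ih j hj).1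
    · exact hc

/-- The absence of flow holds for two external legs too, since the two internal lines supply the
missing fields. So the `c c̄` function at momentum zero is the constant `-mcbc` in `Λ`, and its
limit at `Λ → 0⁺` is zero by assumption. -/
theorem mcbc_eq_zero {ξ g M Λ₀ : ℝ} (hM : 0 < M) (hMΛ₀ : M ≤ Λ₀)
    {r : BareConstants} (hyp1 : StrictlyRelevantConditions ξ g Λ₀ r)
    (hyp2 : MarginalConditions ξ g Λ₀ M r) : r.mcbc = 0 := by
  ext l
  have hlegs : ∀ x ∈ ([(.c 0, 0), (.cbar 0, 0)] : List Leg), x.1.IsField := by simp [Lab.IsField]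
  have hconst : ∀ Λ, 0 < Λ → Λ ≤ Λ₀ →
      vertexFn ξ g Λ₀ r l Λ 0 ![.c 0, .cbar 0] 0 = -PowerSeries.coeff l r.mcbc := by
    intro Λ h h'
    have hl : List.ofFn (fun i => (![Lab.c 0, Lab.cbar 0] i, (0 : Fin 2 → Mom) i))
        = [(.c 0, 0), (.cbar 0, 0)] := by simp
    obtain ⟨m1, m2, m3, m4, m5⟩ := mon_apply_two 0 0
    rw [vertexFn, List.rotate_zero, hl, vertex_eq_coeff ξ g Λ₀ r (P := Leg.IsFieldOrKappa)
      (fun x hx => Or.inl hx)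
      (fun j _ => (marginalCoeffsVanish_and_vertex_eq_zero hM hMΛ₀ hyp2 j).2) h h'
      ⟨fun x hx => Or.inl (hlegs x hx), by simp [total], 0, by simp⟩,
      lagrAux_apply_of_isField ξ g Λ₀ r hlegs, lagr_apply ξ g r (b := 0) (by simp),
      m1, m2, m3, m4, m5, monMass_apply]
    simp
  have hlim := hyp1 l 1 0 ![.c 0, .cbar 0] (by simp) (by simp)
    (by simp [Fin.forall_fin_two, Lab.IsField]) [] (by simp) (by simp)
  have hev : (fun Λ => momDeriv 0 [] (vertexFn ξ g Λ₀ r l Λ 0 ![.c 0, .cbar 0]) 0)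
      =ᶠ[𝓝[>] 0] fun _ => -PowerSeries.coeff l r.mcbc := by
    filter_upwards [Ioc_mem_nhdsGT (hM.trans_le hMΛ₀)] with Λ hΛ
    exact hconst Λ hΛ.1 hΛ.2
  simpa using tendsto_nhds_unique (hlim.congr' hev) tendsto_const_nhds

/-- Vertex functions with at least three field legs, among them an antighost at momentum zero,
vanish, `ρ` being inserted at momentum zero only. -/
theorem vertex_eq_zero {ξ g Λ₀ : ℝ} {r : BareConstants}
    (h1 : r.rcbccbc = 0) (h2 : r.rcbcAA1 = 0) (h3 : r.rcbcAA2 = 0) (h4 : r.rAcbc2 = 0)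
    (h5 : r.mcbc = 0) (l : ℕ) : ∀ Λ, 0 < Λ → Λ ≤ Λ₀ → ∀ legs,
      IsAntighostConfig (fun x => x.1 = .rho → x.2 = 0) legs → 3 ≤ fieldCount legs →
        vertex ξ g Λ₀ r l Λ legs = 0 := by
  induction l using Nat.strong_induction_on with
  | _ l ih =>
    intro Λ h h' legs hl _
    rw [vertex_eq_coeff ξ g Λ₀ r (fun x hx hr => by simp [hr, Lab.IsField] at hx) ih h h' hl]
    obtain ⟨hr, h0, b, hb⟩ := hl
    rw [lagrAux_eq_zero ξ g Λ₀ r h1 h2 h3 h4 h5 hb h0 hr, map_zero]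

/-! ### Momentum derivatives -/

/-- A function which vanishes on the momenta with sum zero, some of them being zero, has vanishing
derivatives there with respect to the other momenta. -/
theorem momDeriv_eq_zero {n : ℕ} {i₀ : Fin n} {T : Set (Fin n)} (hi₀ : i₀ ∉ T)
    {F : (Fin n → Mom) → ℂ}
    (hF : ∀ p : Fin n → Mom, ∑ i, p i = 0 → (∀ i ∈ T, p i = 0) → F p = 0)
    (w : List (Fin n × Fin 4)) (hw : ∀ d ∈ w, d.1 ∉ T)
    (p : Fin n → Mom) (hp : ∑ i, p i = 0) (hpT : ∀ i ∈ T, p i = 0) :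
    momDeriv i₀ w F p = 0 := by
  induction w generalizing p with
  | nil => exact hF p hp hpT
  | cons d w ih =>
    have hd := hw d List.mem_cons_self
    have hline : ∀ t : ℝ, momDeriv i₀ w F
        (p + t • (Pi.single d.1 (EuclideanSpace.single d.2 (1 : ℝ))
          - Pi.single i₀ (EuclideanSpace.single d.2 (1 : ℝ)))) = 0 := by
      intro t
      -- The direction of differentiation has momentum sum zero and no component in `T`, so the
      -- whole line stays in the set where the lower derivative vanishes.
      refine ih (fun d hd => hw d (List.mem_cons_of_mem _ hd)) _ ?_ fun i hi => ?_
      · simp [Finset.sum_add_distrib, ← Finset.smul_sum, hp]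
      · simp [hpT i hi, Pi.single_eq_of_ne (ne_of_mem_of_not_mem hi hd),
          Pi.single_eq_of_ne (ne_of_mem_of_not_mem hi hi₀)]
    simp [momDeriv, lineDeriv, hline]

theorem total_rotate_ofFn {n : ℕ} (Ψ : Fin n → Lab) (p : Fin n → Mom) (k : ℕ) :
    total ((List.ofFn fun i => (Ψ i, p i)).rotate k) = ∑ i, p i := by
  rw [total_perm (List.rotate_perm _ _), total, List.map_ofFn, List.sum_ofFn]
  rfl

theorem mem_rotate_ofFn {n : ℕ} {Ψ : Fin n → Lab} {p : Fin n → Mom} {k : ℕ} {x : Leg} :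
    x ∈ (List.ofFn fun i => (Ψ i, p i)).rotate k ↔ ∃ i, (Ψ i, p i) = x := by
  rw [List.mem_rotate, List.mem_ofFn]

theorem three_le_fieldCount {n m : ℕ} {Ψ : Fin (n + 1) → Lab} (hm : m + 3 ≤ n + 1)
    (h : ∀ i : Fin (n + 1), m ≤ (i : ℕ) → (Ψ i).IsField) (p : Fin (n + 1) → Mom) (k : ℕ) :
    3 ≤ fieldCount ((List.ofFn fun i => (Ψ i, p i)).rotate k) := by
  rw [fieldCount, (List.rotate_perm _ _).countP_eq]
  refine le_trans ?_ ((List.drop_sublist m _).countP_le)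
  rw [List.countP_eq_length.2]
  · simp; omega
  · intro x hx
    obtain ⟨i, hi, rfl⟩ := List.mem_drop_iff_getElem.1 hx
    rw [List.getElem_ofFn]
    simpa using h ⟨m + i, by simpa [add_comm] using hi⟩ (by simp)

end YangMills

end

/-! ### The proposition -/

theorem mainTheorem5 (ξ g M Λ₀ : ℝ) (hξ : 0 < ξ) (hM : 0 < M) (hMΛ₀ : M ≤ Λ₀)
    (r : YangMills.BareConstants)
    (hyp1 : YangMills.StrictlyRelevantConditions ξ g Λ₀ r)
    (hyp2 : YangMills.MarginalConditions ξ g Λ₀ M r) :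
    -- vertex functions without insertions
    (∀ (l n : ℕ) (Ψ : Fin (n + 1) → YangMills.Lab), 3 ≤ n + 1 →
      (∀ i, (Ψ i).IsField) → (∃ b, Ψ (Fin.last n) = YangMills.Lab.cbar b) →
      ∀ w : List (Fin (n + 1) × Fin 4), (∀ d ∈ w, d.1 ≠ 0 ∧ d.1 ≠ Fin.last n) →
      ∀ Λ : ℝ, 0 < Λ → Λ ≤ Λ₀ →
      ∀ p : Fin (n + 1) → YangMills.Mom, ∑ i, p i = 0 → p (Fin.last n) = 0 →
        YangMills.momDeriv 0 w (YangMills.vertexFn ξ g Λ₀ r l Λ 0 Ψ) p = 0) ∧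
    -- counterterms
    (r.rcbcAA1 = 0 ∧ r.rcbccbc = 0 ∧ r.rcbcAA2 = 0 ∧ r.rAcbc2 = 0) ∧
    -- vertex functions with one insertion of `β` and `k` insertions of `γ`, `ω`
    (∀ (l n k : ℕ) (Ψ : Fin (n + 1) → YangMills.Lab), k + 1 + 3 ≤ n + 1 →
      (∃ a, Ψ 0 = YangMills.Lab.beta a) →
      (∀ i : Fin (n + 1), 1 ≤ (i : ℕ) → (i : ℕ) < k + 1 → (Ψ i).IsKappa) →
      (∀ i : Fin (n + 1), k + 1 ≤ (i : ℕ) → (Ψ i).IsField) →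
      (∃ b, Ψ (Fin.last n) = YangMills.Lab.cbar b) →
      ∀ w : List (Fin (n + 1) × Fin 4), (∀ d ∈ w, d.1 ≠ 0 ∧ d.1 ≠ Fin.last n) →
      ∀ Λ : ℝ, 0 < Λ → Λ ≤ Λ₀ →
      ∀ p : Fin (n + 1) → YangMills.Mom, ∑ i, p i = 0 → p (Fin.last n) = 0 →
        YangMills.momDeriv 0 w (YangMills.vertexFn ξ g Λ₀ r l Λ (k + 1) Ψ) p = 0) ∧
    -- vertex functions with one integrated insertion of `ρ`, that is with `ρ` at momentum zero,
    -- and `k` insertions of `γ`, `ω`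
    (∀ (l n k : ℕ) (Ψ : Fin (n + 1) → YangMills.Lab), k + 1 + 3 ≤ n + 1 →
      Ψ 0 = YangMills.Lab.rho →
      (∀ i : Fin (n + 1), 1 ≤ (i : ℕ) → (i : ℕ) < k + 1 → (Ψ i).IsKappa) →
      (∀ i : Fin (n + 1), k + 1 ≤ (i : ℕ) → (Ψ i).IsField) →
      (∃ b, Ψ (Fin.last n) = YangMills.Lab.cbar b) →
      ∀ w : List (Fin (n + 1) × Fin 4), (∀ d ∈ w, d.1 ≠ 0 ∧ d.1 ≠ 1 ∧ d.1 ≠ Fin.last n) →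
      ∀ Λ : ℝ, 0 < Λ → Λ ≤ Λ₀ →
      ∀ p : Fin (n + 1) → YangMills.Mom, ∑ i, p i = 0 → p 0 = 0 → p (Fin.last n) = 0 →
        YangMills.momDeriv 1 w (YangMills.vertexFn ξ g Λ₀ r l Λ (k + 1) Ψ) p = 0) := by

  have hc := fun l => (YangMills.marginalCoeffsVanish_and_vertex_eq_zero hM hMΛ₀ hyp2 l).1
  have c1 : r.rcbcAA1 = 0 := PowerSeries.ext fun l => (hc l).1
  have c2 : r.rcbccbc = 0 := PowerSeries.ext fun l => (hc l).2.1
  have c3 : r.rcbcAA2 = 0 := PowerSeries.ext fun l => (hc l).2.2.1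
  have c4 : r.rAcbc2 = 0 := PowerSeries.ext fun l => (hc l).2.2.2
  have hv := fun l => YangMills.vertex_eq_zero (ξ := ξ) (g := g) (Λ₀ := Λ₀) c2 c1 c3 c4
    (YangMills.mcbc_eq_zero hM hMΛ₀ hyp1 hyp2) l
  refine ⟨?_, ⟨c1, c2, c3, c4⟩, ?_, ?_⟩
  · rintro l n Ψ hn hΨ ⟨b, hb⟩ w hw Λ hΛ hΛ₀ p hp hp0
    refine YangMills.momDeriv_eq_zero (T := {Fin.last n})
      (by simp [Fin.ext_iff]; omega) (fun q hq hqT => ?_) w (fun d hd => (hw d hd).2) p hp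
      (by simpa using hp0)
    refine hv l Λ hΛ hΛ₀ _ ⟨fun x hx hx' => ?_, ?_, b, ?_⟩
      (YangMills.three_le_fieldCount (m := 0) (by omega) (fun i _ => hΨ i) q 0)
    · obtain ⟨i, rfl⟩ := YangMills.mem_rotate_ofFn.1 hx
      have := hΨ i
      simp only at hx'
      rw [hx'] at this
      exact this.elim
    · rw [YangMills.total_rotate_ofFn, hq]
    · exact YangMills.mem_rotate_ofFn.2 ⟨Fin.last n, by rw [hb, hqT _ rfl]⟩
  · rintro l n k Ψ hn ⟨a, ha⟩ hκ hΨ ⟨b, hb⟩ w hw Λ hΛ hΛ₀ p hp hp0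
    refine YangMills.momDeriv_eq_zero (T := {Fin.last n})
      (by simp [Fin.ext_iff]; omega) (fun q hq hqT => ?_) w (fun d hd => (hw d hd).2) p hp
      (by simpa using hp0)
    refine hv l Λ hΛ hΛ₀ _ ⟨fun x hx hx' => ?_, ?_, b, ?_⟩
      (YangMills.three_le_fieldCount (m := k + 1) hn hΨ q (k + 1))
    · obtain ⟨i, rfl⟩ := YangMills.mem_rotate_ofFn.1 hx
      simp only at hx'
      by_cases hi : k + 1 ≤ (i : ℕ)
      · have := hΨ i hi
        rw [hx'] at this
        exact this.elim
      · by_cases hi0 : i = 0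
        · rw [hi0, ha] at hx'
          cases hx'
        · have := hκ i (Nat.one_le_iff_ne_zero.2 fun h => hi0 (Fin.ext h)) (by omega)
          rw [hx'] at this
          exact this.elim
    · rw [YangMills.total_rotate_ofFn, hq]
    · exact YangMills.mem_rotate_ofFn.2 ⟨Fin.last n, by rw [hb, hqT _ rfl]⟩
  · rintro l n k Ψ hn hρ hκ hΨ ⟨b, hb⟩ w hw Λ hΛ hΛ₀ p hp hp00 hp0
    have h1 : ((1 : Fin (n + 1)) : ℕ) = 1 := by
      rw [Fin.val_one', Nat.mod_eq_of_lt (by omega)]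
    -- The integrated insertion keeps `ρ`, the entry `0`, at momentum zero, so the momentum
    -- eliminated by conservation is that of entry `1`, which differs from `0` and from the last
    -- entry as there are at least four legs.
    refine YangMills.momDeriv_eq_zero (T := {0, Fin.last n})
      (by
        rintro (h | h)
        · have := h1.symm.trans (congrArg Fin.val h)
          rw [Fin.val_zero] at this
          omega
        · have := h1.symm.trans (congrArg Fin.val h)
          rw [Fin.val_last] at this
          omega) (fun q hq hqT => ?_) w
      (fun d hd => by simp [(hw d hd).1, (hw d hd).2.2]) p hp
      (by simp [hp00, hp0])
    refine hv l Λ hΛ hΛ₀ _ ⟨fun x hx hx' => ?_, ?_, b, ?_⟩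
      (YangMills.three_le_fieldCount (m := k + 1) hn hΨ q (k + 1))
    · obtain ⟨i, rfl⟩ := YangMills.mem_rotate_ofFn.1 hx
      simp only at hx'
      by_cases hi : k + 1 ≤ (i : ℕ)
      · have := hΨ i hi
        rw [hx'] at this
        exact this.elim
      · by_cases hi0 : i = 0
        · exact hqT i (by simp [hi0])
        · have := hκ i (Nat.one_le_iff_ne_zero.2 fun h => hi0 (Fin.ext h)) (by omega)
          rw [hx'] at this
          exact this.elim
    · rw [YangMills.total_rotate_ofFn, hq]
    · exact YangMills.mem_rotate_ofFn.2 ⟨Fin.last n, by rw [hb, hqT _ (by simp)]⟩
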